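/- Conventions. For integers $\lambda, N\ge 0$, $\lambda K_N$ is the loopless multigraph on $N$ vertices in which every two distinct vertices are joined by exactly $\lambda$ edges; for $n\le N$, $\lambda K_n$ is regarded as a subgraph of $\lambda K_N$. A \emph{decomposition of size $k$} of a multigraph $G$ is a family $\mathcal A(1),\dots,\mathcal A(k)$ of spanning subgraphs of $G$ (the \emph{colour classes}; they may have isolated vertices, or no edges at all) whose edge sets are pairwise disjoint and have union $E(G)$. It is a \emph{path decomposition} if every colour class is a vertex-disjoint union of paths (possibly trivial, i.e. single vertices) and cycles (a pair of parallel edges is a cycle of length 2). It is a \emph{2-factorization} if every colour class is a 2-factor, that is, a 2-regular spanning subgraph; a \emph{Hamiltonian cycle} is a connected 2-factor. A decomposition $\mathcal A$ of $\lambda K_n$ of size $k$ is \emph{embedded} in a decomposition $\mathcal F$ of $\lambda K_{n+m}$ of size $k$ if $\mathcal A(i)$ is a subgraph of $\mathcal F(i)$ for $1\le i\le k$. Lemma. Let $k, m, n, r, \lambda$ be non-negative integers with $n+m\ge 1$, and let $\mathcal A$ be a path decomposition of $\lambda K_n$ of size $k$ in which at least $r$ of the colour classes are cycle-free. Then $\mathcal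 A$ can be embedded in a 2-factorization of $\lambda K_{n+m}$ (of size $k$) in which at least $r$ of the 2-factors are Hamiltonian cycles if and only if (Y1) $k=\lambda(n+m-1)/2$ (in particular, this number is an integer), and (Y2) for $1\le i\le k$, at most $m$ of the connected components of $\mathcal A(i)$ are paths (trivial paths included). Moreover, if $m\ge 1$ and exactly $r$ of the colour classes of $\mathcal A$ are cycle-free, then $\mathcal A$ can be embedded in a 2-factorization of $\lambda K_{n+m}$ (of size $k$) in which exactly $r$ of the 2-factors are Hamiltonian cycles if and only if (Y1) and (Y2) hold. -/

import Mathlib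

namespace Graph

universe u v

variable {α : Type u} {β : Type v}

/-- The complete multigraph in which every edge has multiplicity `lam`, on the vertex set
`{0, ..., n - 1}`.  The edges joining two distinct vertices `x` and `y` are the labelled pairs
`(s(x, y), j)` with `j < lam`.  With this labelling, the complete multigraph on `n` vertices is
literally a subgraph of the one on `n + m` vertices. -/
def completeMultigraph (lam n : ℕ) : Graph ℕ (Sym2 ℕ × ℕ) where
  vertexSet := {x | x < n}
  IsLink e x y := e.1 = s(x, y) ∧ x ≠ y ∧ x < n ∧ y < n ∧ e.2 < lam
  isLink_symm := by
    intro e _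
    exact ⟨fun x y h => ⟨by rw [h.1, Sym2.eq_swap], h.2.1.symm, h.2.2.2.1, h.2.2.1, h.2.2.2.2⟩⟩
  eq_or_eq_of_isLink_of_isLink := by
    intro e x y z w h h'
    have h'' : s(x, y) = s(z, w) := h.1.symm.trans h'.1
    rcases Sym2.eq_iff.1 h'' with h3 | h3
    · exact Or.inl h3.1
    · exact Or.inr h3.1
  left_mem_of_isLink := by
    intro e x y h
    exact h.2.2.1

/-- `G` is a path: it has distinct vertices `x 0, ..., x l` and distinct edges
`e 0, ..., e (l - 1)` such that `e i` joins `x i` and `x (i + 1)`, and no others.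
The case `l = 0` is the trivial path consisting of a single vertex. -/
def IsPathGraph (G : Graph α β) : Prop :=
  ∃ (l : ℕ) (x : Fin (l + 1) → α) (e : Fin l → β),
    Function.Injective x ∧ Function.Injective e ∧
    G.vertexSet = Set.range x ∧ G.edgeSet = Set.range e ∧
    ∀ i : Fin l, G.IsLink (e i) (x i.castSucc) (x i.succ)

/-- `G` is a cycle: it has distinct vertices `x 0, ..., x l` and distinct edges `e 0, ..., e l`
such that `e i` joins `x i` and `x (i + 1)`, the indices being read modulo `l + 1`, and no others.
The case `l = 1` is a cycle of length two formed by two parallel edges; the case `l = 0` is a loop,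
which does not occur in a loopless graph. -/
def IsCycleGraph (G : Graph α β) : Prop :=
  ∃ (l : ℕ) (x : Fin (l + 1) → α) (e : Fin (l + 1) → β),
    Function.Injective x ∧ Function.Injective e ∧
    G.vertexSet = Set.range x ∧ G.edgeSet = Set.range e ∧
    ∀ i : Fin (l + 1), G.IsLink (e i) (x i) (x (i + 1))

/-- `G` is nonempty, and any two of its vertices are joined by a walk. -/
def IsConnectedGraph (G : Graph α β) : Prop :=
  G.vertexSet.Nonempty ∧
    ∀ x ∈ G.vertexSet, ∀ y ∈ G.vertexSet, Relation.ReflTransGen G.Adj x y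

/-- `C` is a connected component of `G`: a connected subgraph that contains every edge of `G`
incident with one of its vertices. -/
def IsComponentOf (C G : Graph α β) : Prop :=
  C.IsClosedSubgraph G ∧ C.IsConnectedGraph

/-- `G` is a disjoint union of paths (possibly trivial) and cycles. -/
def IsUnionOfPathsAndCycles (G : Graph α β) : Prop :=
  ∀ C : Graph α β, C.IsComponentOf G → C.IsPathGraph ∨ C.IsCycleGraph

/-- The set of the paths (including the trivial ones) among the connected components of `G`. -/
def pathComponents (G : Graph α β) : Set (Graph α β) :=
  {C | C.IsComponentOf G ∧ C.IsPathGraph}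

/-- No subgraph of `G` is a cycle. -/
def IsCycleFree (G : Graph α β) : Prop :=
  ∀ C : Graph α β, C ≤ G → ¬ C.IsCycleGraph

/-- The degree of a vertex, where loops count twice. -/
noncomputable def vertexDegree (G : Graph α β) (x : α) : ℕ∞ :=
  (G.incidenceSet x).encard + (G.loopSet x).encard

/-- `F` is a 2-factor of `G`: a 2-regular spanning subgraph. -/
def IsTwoFactorOf (F G : Graph α β) : Prop :=
  F.IsSpanningSubgraph G ∧ ∀ x ∈ F.vertexSet, F.vertexDegree x = 2

/-- `F` is a Hamiltonian cycle of `G`: a connected 2-factor. -/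
def IsHamiltonianCycleOf (F G : Graph α β) : Prop :=
  F.IsTwoFactorOf G ∧ F.IsConnectedGraph

/-- A decomposition of `G` of size `k`: spanning subgraphs `D 0, ..., D (k - 1)` of `G` (the colour
classes) whose edge sets are pairwise disjoint and cover the edge set of `G`. -/
structure IsDecomposition {k : ℕ} (D : Fin k → Graph α β) (G : Graph α β) : Prop where
  spanning : ∀ i, (D i).IsSpanningSubgraph G
  cover : G.edgeSet = ⋃ i, (D i).edgeSet
  disjoint : ∀ i j, i ≠ j → Disjoint (D i).edgeSet (D j).edgeSet

/-- A decomposition each of whose colour classes is a disjoint union of paths and cycles. -/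
def IsPathDecomposition {k : ℕ} (D : Fin k → Graph α β) (G : Graph α β) : Prop :=
  IsDecomposition D G ∧ ∀ i, (D i).IsUnionOfPathsAndCycles

/-- A decomposition into 2-factors. -/
def IsTwoFactorization {k : ℕ} (D : Fin k → Graph α β) (G : Graph α β) : Prop :=
  IsDecomposition D G ∧ ∀ i, (D i).IsTwoFactorOf G

/-- The decomposition `A` is embedded in the decomposition `F` of the same size: each colour class
of `A` is a subgraph of the corresponding colour class of `F`. -/
def IsEmbeddedIn {k : ℕ} (A F : Fin k → Graph α β) : Prop :=
  ∀ i, A i ≤ F i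

/-- The number of cycle-free colour classes. -/
noncomputable def numCycleFree {k : ℕ} (A : Fin k → Graph α β) : ℕ :=
  {i | (A i).IsCycleFree}.ncard

/-- The number of colour classes that are Hamiltonian cycles of `G`. -/
noncomputable def numHamiltonian {k : ℕ} (F : Fin k → Graph α β) (G : Graph α β) : ℕ :=
  {i | (F i).IsHamiltonianCycleOf G}.ncard

end Graph

/-! Sufficiency: the missing vertices are added one at a time, and only edge multiplicities are
tracked. The deficiency of a vertex in a colour class is the number of edges it still needs there.
Under (Y1) the deficiencies of an old vertex, summed over all classes, give `lam` times the number
of vertices still to come; under (Y2) those within one class sum to at most twice that number. When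
`m` vertices are missing, the next one takes a fair share, one `m`-th up to rounding, of each
relevant sum: exactly `lam` edges to each old vertex, at most two edges in each class and, in a
class made of paths, at most one end of each path while `m > 1`. So paths are merged but not closed
before the last vertex, which closes the single remaining path into a Hamiltonian cycle. A parity
argument preserves the bound from (Y2) (`IsExtendable.exists_addVertex`).

A fair share exists because the sums run over the classes of one partition (by old vertex) and of a
chain of two partitions (path within colour class, colour class) of the units of deficiency. To
halve a set fairly, pair its elements inside the classes, once for the single partition and once for
the chain; the union of two matchings is bipartite, and a proper two-colouring splits all pairs
(`exists_balanced_bool`). Rebalancing two colours at a time yields `m` fair shares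
(`exists_balanced_coloring`).

Necessity is counting: degrees at one vertex give (Y1), and edges between old and new vertices
within a class give (Y2). For the exact count, a class that misses a vertex of a Hamiltonian cycle
containing it has no cycle (`IsHamiltonianCycleOf.isCycleFree`). -/

/-! ### Balanced colourings and fair shares of a matrix -/

/-- The union of two perfect matchings has only even cycles and two-way infinite paths. Both
involutions carry each orbit of `σ * τ` to the same different orbit, so it suffices to colour the
two partner orbits differently, here by comparing them in a linear order. -/
theorem exists_bool_of_fixedPointFree {α : Type*} (σ τ : Equiv.Perm α)
    (hσ : ∀ x, σ (σ x) = x) (hτ : ∀ x, τ (τ x) = x) (hσ' : ∀ x, σ x ≠ x) (hτ' : ∀ x, τ x ≠ x) :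
    ∃ χ : α → Bool, (∀ x, χ (σ x) ≠ χ x) ∧ ∀ x, χ (τ x) ≠ χ x := by
  set ρ := σ * τ with hρ
  have hinv : σ⁻¹ = σ := by
    ext x; rw [Equiv.Perm.inv_eq_iff_eq, hσ]
  have hinvτ : τ⁻¹ = τ := by
    ext x; rw [Equiv.Perm.inv_eq_iff_eq, hτ]
  have hρi : ρ⁻¹ = τ * σ := by rw [hρ, mul_inv_rev, hinv, hinvτ]
  have hσσ : σ * σ = 1 := by ext x; exact hσ x
  have hconj : ∀ (i : ℤ) x, σ ((ρ ^ i) x) = (ρ ^ (-i)) (σ x) := by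
    intro i x
    have h1 : σ * ρ * σ⁻¹ = ρ⁻¹ := by
      rw [hρi, hinv, hρ]; calc σ * (σ * τ) * σ = (σ * σ) * τ * σ := by group
        _ = _ := by rw [hσσ, one_mul]
    have h2 : σ * ρ ^ i * σ⁻¹ = ρ ^ (-i) := by
      rw [← conj_zpow, h1, inv_zpow, zpow_neg]
    rw [← h2]
    simp
  -- If `σ x = (ρ ^ i) x`, the midpoint `(ρ ^ d) x` would be fixed by `σ` when `i = 2 * d`, and by
  -- `τ` when `i = 2 * d + 1`.
  have key : ∀ x, ¬ ρ.SameCycle x (σ x) := by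
    rintro x ⟨i, hi⟩
    rcases Int.even_or_odd' i with ⟨d, rfl | rfl⟩
    · apply hσ' ((ρ ^ d) x)
      rw [hconj, ← hi, ← Equiv.Perm.mul_apply, ← zpow_add]
      congr 2; ring
    · apply hτ' ((ρ ^ d) x)
      have h3 : τ ((ρ ^ d) x) = σ ((ρ ^ (d + 1)) x) := by
        rw [add_comm, zpow_add, zpow_one, Equiv.Perm.mul_apply, hρ, Equiv.Perm.mul_apply, hσ]
      rw [h3, hconj, ← hi, ← Equiv.Perm.mul_apply, ← zpow_add]
      congr 2; ring
  let Q := Quotient (Equiv.Perm.SameCycle.setoid ρ)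
  let c : α → Q := fun x => Quotient.mk _ x
  have hc : ∀ x y, c x = c y ↔ ρ.SameCycle x y := fun x y => Quotient.eq
  have hcσ : ∀ x y, c x = c y → c (σ x) = c (σ y) := by
    intro x y h
    rw [hc] at h ⊢
    obtain ⟨i, hi⟩ := h
    exact ⟨-i, by rw [← hconj, hi]⟩
  have hne : ∀ x, c x ≠ c (σ x) := fun x h => key x ((hc _ _).1 h)
  have hcτ : ∀ x, c (τ x) = c (σ x) := by
    intro x
    have h : c (ρ x) = c x := ((hc _ _).2 (Equiv.Perm.sameCycle_apply_right.2
      (Equiv.Perm.SameCycle.refl _ _))).symm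
    have := hcσ _ _ h
    rwa [hρ, Equiv.Perm.mul_apply, hσ] at this
  classical
  let : LinearOrder Q := linearOrderOfSTO WellOrderingRel
  have aux : ∀ a b : Q, a ≠ b → decide (b < a) ≠ decide (a < b) := by
    intro a b hab h
    rcases lt_or_gt_of_ne hab with h' | h'
    · simp [h', not_lt.2 h'.le] at h
    · simp [h', not_lt.2 h'.le] at h
  refine ⟨fun x => decide (c x < c (σ x)), fun x => ?_, fun x => ?_⟩
  · simp only [hσ]
    exact aux _ _ (hne x)
  · have h1 : c (σ (τ x)) = c x := by
      rw [hcσ _ _ (hcτ x), hσ]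
    simp only [hcτ, h1]
    exact aux _ _ (hne x)

/-- Two matchings, given as involutions, are simultaneously split by a two-colouring. -/
theorem exists_bool_of_involutive {α : Type*} (σ τ : α → α)
    (hσ : Function.Involutive σ) (hτ : Function.Involutive τ) :
    ∃ χ : α → Bool, (∀ x, σ x ≠ x → χ (σ x) ≠ χ x) ∧ ∀ x, τ x ≠ x → χ (τ x) ≠ χ x := by
  classical
  -- Fixed points are removed by doubling the set: a fixed point is matched with its own copy in the
  -- other layer.
  let lift : (α → α) → α × Bool → α × Bool := fun f x =>
    if f x.1 = x.1 then (x.1, !x.2) else (f x.1, x.2)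
  have hl : ∀ f : α → α, Function.Involutive f → Function.Involutive (lift f) := by
    rintro f hf ⟨x, b⟩
    by_cases h : f x = x
    · simp [lift, h]
    · have : ¬ f (f x) = f x := by rw [hf]; exact Ne.symm h
      simp [lift, h, hf x, Ne.symm h]
  have hl' : ∀ (f : α → α) x, lift f x ≠ x := by
    rintro f ⟨x, b⟩
    by_cases h : f x = x <;> simp [lift, h]
  obtain ⟨χ, h1, h2⟩ := exists_bool_of_fixedPointFree (hl σ hσ).toPerm (hl τ hτ).toPerm
    (hl σ hσ) (hl τ hτ) (hl' σ) (hl' τ)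
  refine ⟨fun x => χ (x, true), fun x hx => ?_, fun x hx => ?_⟩
  · simpa [lift, hx] using h1 (x, true)
  · simpa [lift, hx] using h2 (x, true)

/-- The elements of a finite set can be paired inside the fibres of a function, with at most
one element of each fibre left over. -/
theorem exists_pairing {α β : Type*} [DecidableEq α] (f : α → β) (s : Finset α) :
    ∃ σ : α → α, Function.Involutive σ ∧ (∀ x, f (σ x) = f x) ∧ (∀ x, x ∉ s → σ x = x) ∧
      ∀ x ∈ s, ∀ y ∈ s, σ x = x → σ y = y → f x = f y → x = y := by
  induction s using Finset.strongInduction with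
  | H s ih =>
    by_cases hinj : ∀ x ∈ s, ∀ y ∈ s, f x = f y → x = y
    · exact ⟨id, fun _ => rfl, fun _ => rfl, fun _ _ => rfl, fun x hx y hy _ _ => hinj x hx y hy⟩
    · push Not at hinj
      obtain ⟨a, ha, b, hb, hab, hne⟩ := hinj
      obtain ⟨σ, h1, h2, h3, h4⟩ := ih ((s.erase a).erase b)
        ((Finset.erase_subset _ _).trans_ssubset (Finset.erase_ssubset ha))
      have hσa : σ a = a := h3 a (by simp)
      have hσb : σ b = b := h3 b (by simp)
      have hA : ∀ x, σ x = a → x = a := fun x hx => by rw [← h1 x, hx, hσa]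
      have hB : ∀ x, σ x = b → x = b := fun x hx => by rw [← h1 x, hx, hσb]
      refine ⟨fun x => if x = a then b else if x = b then a else σ x, ?_, ?_, ?_, ?_⟩
      · intro x
        dsimp only
        by_cases hxa : x = a
        · simp [hxa, Ne.symm hne]
        · by_cases hxb : x = b
          · simp [hxb, Ne.symm hne]
          · simp only [hxa, hxb, if_false]
            rw [if_neg (fun h => hxa (hA x h)), if_neg (fun h => hxb (hB x h)), h1]
      · intro x
        dsimp only
        split_ifs with h h'
        · rw [h, hab]
        · rw [h', hab]
        · exact h2 x
      · intro x hx
        dsimp only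
        rw [if_neg (fun h : x = a => hx (h ▸ ha)), if_neg (fun h : x = b => hx (h ▸ hb))]
        exact h3 x (fun h => hx (Finset.mem_of_mem_erase (Finset.mem_of_mem_erase h)))
      · intro x hx y hy
        dsimp only
        intro hx' hy' hxy
        have hxa : x ≠ a := by rintro rfl; simp at hx'; exact hne hx'.symm
        have hxb : x ≠ b := by rintro rfl; simp [Ne.symm hne] at hx'; exact hne hx'
        have hya : y ≠ a := by rintro rfl; simp at hy'; exact hne hy'.symm
        have hyb : y ≠ b := by rintro rfl; simp [Ne.symm hne] at hy'; exact hne hy'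
        simp only [hxa, hxb, hya, hyb, if_false] at hx' hy'
        exact h4 x (by simp [*]) y (by simp [*]) hx' hy' hxy

/-- A two-colouring splitting the pairs of an involution that preserves `F` is balanced on `F`,
if at most one element of `F` is unpaired. -/
theorem card_filter_le_card_filter_add_one {α : Type*} (σ : α → α) (χ : α → Bool)
    (F : Finset α) (hσ : Function.Involutive σ) (hF : ∀ x ∈ F, σ x ∈ F)
    (hχ : ∀ x, σ x ≠ x → χ (σ x) ≠ χ x)
    (hfix : ∀ x ∈ F, ∀ y ∈ F, σ x = x → σ y = y → x = y) (b : Bool) :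
    (F.filter fun x => χ x = b).card ≤ (F.filter fun x => χ x = !b).card + 1 := by
  classical
  have h1 : (F.filter fun x => χ x = b ∧ σ x ≠ x).card
      ≤ (F.filter fun x => χ x = !b).card := by
    refine Finset.card_le_card_of_injOn σ ?_ hσ.injective.injOn
    intro x hx
    simp only [Finset.coe_filter, Set.mem_ofPred_eq] at hx ⊢
    obtain ⟨hx1, hx2, hx3⟩ := hx
    refine ⟨hF x hx1, ?_⟩
    have := hχ x hx3
    rw [hx2] at this
    cases b <;> simpa using this
  have h2 : (F.filter fun x => χ x = b ∧ σ x = x).card ≤ 1 := by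
    rw [Finset.card_le_one]
    intro x hx y hy
    simp only [Finset.mem_filter] at hx hy
    exact hfix x hx.1 y hy.1 hx.2.2 hy.2.2
  have h3 : (F.filter fun x => χ x = b).card = (F.filter fun x => χ x = b ∧ σ x = x).card +
      (F.filter fun x => χ x = b ∧ σ x ≠ x).card := by
    rw [← Finset.card_filter_add_card_filter_not (s := F.filter fun x => χ x = b)
      (fun x => σ x = x), Finset.filter_filter, Finset.filter_filter]
  omega

/-- Balanced two-colouring of a finite set with respect to a partition and a chain of two
partitions. -/
theorem exists_balanced_bool {α U P C : Type*} [DecidableEq α] [DecidableEq U] [DecidableEq P]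
    [DecidableEq C] (f : α → U) (p : α → P) (q : P → C) (s : Finset α) :
    ∃ χ : α → Bool, ∀ b : Bool,
      (∀ u, ((s.filter fun x => f x = u).filter fun x => χ x = b).card ≤
        ((s.filter fun x => f x = u).filter fun x => χ x = !b).card + 1) ∧
      (∀ u, ((s.filter fun x => p x = u).filter fun x => χ x = b).card ≤
        ((s.filter fun x => p x = u).filter fun x => χ x = !b).card + 1) ∧
      (∀ u, ((s.filter fun x => q (p x) = u).filter fun x => χ x = b).card ≤
        ((s.filter fun x => q (p x) = u).filter fun x => χ x = !b).card + 1) := by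
  have hmem : ∀ (σ : α → α) (t : Finset α), Function.Involutive σ → (∀ x, x ∉ t → σ x = x) →
      ∀ x ∈ t, σ x ∈ t := by
    intro σ t h1 h2 x hx
    by_contra h
    have := h2 _ h
    rw [h1] at this
    exact h (this ▸ hx)
  obtain ⟨σ, s1, s2, s3, s4⟩ := exists_pairing f s
  obtain ⟨τ₁, t1, t2, t3, t4⟩ := exists_pairing p s
  obtain ⟨τ₂, r1, r2, r3, r4⟩ := exists_pairing (fun x => q (p x)) (s.filter fun x => τ₁ x = x)
  -- One matching serves both partitions of the chain: pair inside the fine classes first, then pair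
  -- the leftovers inside the coarse classes.
  let τ : α → α := fun x => if τ₁ x = x then τ₂ x else τ₁ x
  have hτ₂ : ∀ x, τ₁ x = x → τ₁ (τ₂ x) = τ₂ x := by
    intro x hx
    by_cases hs : x ∈ s.filter fun x => τ₁ x = x
    · exact (Finset.mem_filter.1 (hmem _ _ r1 r3 x hs)).2
    · rw [r3 x hs, hx]
  have hτ : Function.Involutive τ := by
    intro x
    by_cases hx : τ₁ x = x
    · simp only [τ, hx, if_true, hτ₂ x hx]
      exact r1 x
    · have : ¬ x = τ₁ x := Ne.symm hx
      simp only [τ, hx, if_false, t1 x, this]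
  have hτs : ∀ x, x ∉ s → τ x = x := by
    intro x hx
    simp only [τ, t3 x hx, if_true]
    exact r3 x (fun h => hx (Finset.mem_filter.1 h).1)
  obtain ⟨χ, c1, c2⟩ := exists_bool_of_involutive σ τ s1 hτ
  refine ⟨χ, fun b => ⟨fun u => ?_, fun u => ?_, fun u => ?_⟩⟩
  · refine card_filter_le_card_filter_add_one σ χ _ s1 ?_ c1 ?_ b
    · intro x hx
      rw [Finset.mem_filter] at hx ⊢
      exact ⟨hmem _ _ s1 s3 x hx.1, by rw [s2, hx.2]⟩
    · intro x hx y hy hx' hy'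
      rw [Finset.mem_filter] at hx hy
      exact s4 x hx.1 y hy.1 hx' hy' (hx.2.trans hy.2.symm)
  · refine card_filter_le_card_filter_add_one τ₁ χ _ t1 ?_ ?_ ?_ b
    · intro x hx
      rw [Finset.mem_filter] at hx ⊢
      exact ⟨hmem _ _ t1 t3 x hx.1, by rw [t2, hx.2]⟩
    · intro x hx
      have := c2 x
      simp only [τ, hx, if_false] at this
      exact this hx
    · intro x hx y hy hx' hy'
      rw [Finset.mem_filter] at hx hy
      exact t4 x hx.1 y hy.1 hx' hy' (hx.2.trans hy.2.symm)
  · refine card_filter_le_card_filter_add_one τ χ _ hτ ?_ c2 ?_ b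
    · intro x hx
      rw [Finset.mem_filter] at hx ⊢
      refine ⟨hmem _ _ hτ hτs x hx.1, ?_⟩
      by_cases h : τ₁ x = x
      · simp only [τ, h, if_true]; rw [r2, hx.2]
      · simp only [τ, h, if_false, t2, hx.2]
    · intro x hx y hy hx' hy'
      rw [Finset.mem_filter] at hx hy
      have fx : ∀ z, τ z = z → τ₁ z = z ∧ τ₂ z = z := by
        intro z hz
        by_cases h : τ₁ z = z
        · simp only [τ, h, if_true] at hz
          exact ⟨h, hz⟩
        · simp only [τ, h, if_false] at hz
      exact r4 x (Finset.mem_filter.2 ⟨hx.1, (fx x hx').1⟩) y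
        (Finset.mem_filter.2 ⟨hy.1, (fx y hy').1⟩) (fx x hx').2 (fx y hy').2
        (hx.2.trans hy.2.symm)

/-- With the sum fixed, the sum of squares grows with the absolute difference, and a difference of
at most one is the least that parity allows. -/
theorem sq_add_sq_le_of_balanced {x y x' y' : ℕ} (h1 : x' + y' = x + y) (h2 : x' ≤ y' + 1)
    (h3 : y' ≤ x' + 1) :
    x' ^ 2 + y' ^ 2 ≤ x ^ 2 + y ^ 2 ∧ (y + 1 < x → x' ^ 2 + y' ^ 2 < x ^ 2 + y ^ 2) := by
  zify at *
  have hd : ((x' : ℤ) - y') ^ 2 ≤ 1 := by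
    have : |(x' : ℤ) - y'| ≤ 1 := abs_le.2 ⟨by linarith, by linarith⟩
    rw [← sq_abs]; nlinarith [abs_nonneg ((x' : ℤ) - y')]
  have key : 2 * ((x : ℤ) ^ 2 + y ^ 2) - 2 * ((x' : ℤ) ^ 2 + y' ^ 2) =
      ((x : ℤ) - y) ^ 2 - ((x' : ℤ) - y') ^ 2 := by
    have hy' : (y' : ℤ) = x + y - x' := by linarith
    rw [hy']; ring
  constructor
  · by_cases hxy : (x : ℤ) = y
    · have h4 : (x' : ℤ) = x := by omega
      have h5 : (y' : ℤ) = y := by omega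
      rw [h4, h5]
    · have : (0 : ℤ) < ((x : ℤ) - y) ^ 2 := by
        have := sub_ne_zero.2 hxy; positivity
      linarith
  · intro h4
    nlinarith

/-- If every subset has a two-colouring balanced on a family of sets, then there is an
`m`-colouring balanced on that family. -/
theorem exists_balanced_coloring {α ι : Type*} [Fintype α] [DecidableEq α] [Fintype ι]
    (F : ι → Finset α)
    (h : ∀ s : Finset α, ∃ χ : α → Bool, ∀ b i, ((F i ∩ s).filter fun x => χ x = b).card ≤
      ((F i ∩ s).filter fun x => χ x = !b).card + 1) (m : ℕ) [NeZero m] :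
    ∃ c : α → Fin m, ∀ i t t', ((F i).filter fun x => c x = t).card ≤
      ((F i).filter fun x => c x = t').card + 1 := by
  let a : (α → Fin m) → ι → Fin m → ℕ := fun c i t => ((F i).filter fun x => c x = t).card
  -- In a colouring minimising the sum of squares, no set can have two colours differing by two or
  -- more: rebalancing just these two colours would increase no term of the outer sum and decrease
  -- one strictly.
  obtain ⟨c, -, hc⟩ := Finset.exists_min_image (Finset.univ : Finset (α → Fin m))
    (fun c => ∑ i, ∑ t, a c i t ^ 2) ⟨fun _ => 0, Finset.mem_univ _⟩
  refine ⟨c, fun i t t' => ?_⟩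
  by_contra! hlt
  have htt : t ≠ t' := by rintro rfl; omega
  obtain ⟨χ, hχ⟩ := h (Finset.univ.filter fun x => c x = t ∨ c x = t')
  let c' : α → Fin m := fun x => if c x = t ∨ c x = t' then (if χ x then t else t') else c x
  have e1 : ∀ j, a c' j t = ((F j ∩ (Finset.univ.filter fun x => c x = t ∨ c x = t')).filter
      fun x => χ x = true).card := by
    intro j
    simp only [a]
    congr 1
    ext x
    simp only [c', Finset.mem_filter, Finset.mem_inter, Finset.mem_univ, true_and]
    by_cases h1 : c x = t ∨ c x = t'
    · cases hx : χ x <;> simp [h1, htt.symm]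
    · simp only [h1, if_false]; tauto
  have e2 : ∀ j, a c' j t' = ((F j ∩ (Finset.univ.filter fun x => c x = t ∨ c x = t')).filter
      fun x => χ x = false).card := by
    intro j
    simp only [a]
    congr 1
    ext x
    simp only [c', Finset.mem_filter, Finset.mem_inter, Finset.mem_univ, true_and]
    by_cases h1 : c x = t ∨ c x = t'
    · cases hx : χ x <;> simp [h1, htt]
    · simp only [h1, if_false]; tauto
  have e3 : ∀ j t'', t'' ≠ t → t'' ≠ t' → a c' j t'' = a c j t'' := by
    intro j t'' h1 h2
    simp only [a]
    congr 1
    ext x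
    simp only [c', Finset.mem_filter]
    by_cases h3 : c x = t ∨ c x = t'
    · cases hx : χ x <;> rcases h3 with h3 | h3 <;> simp [h3, h1.symm, h2.symm]
    · simp only [h3, if_false]
  have e4 : ∀ j, a c' j t + a c' j t' = a c j t + a c j t' := by
    intro j
    have hs : ∀ d : α → Fin m, a d j t + a d j t' =
        ((F j).filter fun x => d x = t ∨ d x = t').card := by
      intro d
      rw [Finset.filter_or, Finset.card_union_of_disjoint]
      rw [Finset.disjoint_filter]
      intro x _ h1 h2
      exact htt (h1.symm.trans h2)
    rw [hs, hs]
    congr 1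
    ext x
    simp only [c', Finset.mem_filter]
    by_cases h3 : c x = t ∨ c x = t'
    · cases hx : χ x <;> simp [h3]
    · simp only [h3, if_false]
  have e5 : ∀ j, a c' j t ≤ a c' j t' + 1 ∧ a c' j t' ≤ a c' j t + 1 := by
    intro j
    rw [e1, e2]
    exact ⟨hχ true j, hχ false j⟩
  have split : ∀ (d : α → Fin m) j, ∑ u, a d j u ^ 2 = a d j t ^ 2 + a d j t' ^ 2 +
      ∑ u ∈ (Finset.univ.erase t).erase t', a d j u ^ 2 := by
    intro d j
    rw [← Finset.add_sum_erase _ _ (Finset.mem_univ t), ← Finset.add_sum_erase _ _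
      (Finset.mem_erase.2 ⟨htt.symm, Finset.mem_univ t'⟩), add_assoc]
  have rest : ∀ j, ∑ u ∈ (Finset.univ.erase t).erase t', a c' j u ^ 2 =
      ∑ u ∈ (Finset.univ.erase t).erase t', a c j u ^ 2 := by
    intro j
    refine Finset.sum_congr rfl fun u hu => ?_
    simp only [Finset.mem_erase] at hu
    rw [e3 j u hu.2.1 hu.1]
  have hlt' : ∑ j, ∑ u, a c' j u ^ 2 < ∑ j, ∑ u, a c j u ^ 2 := by
    refine Finset.sum_lt_sum (fun j _ => ?_) ⟨i, Finset.mem_univ i, ?_⟩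
    · rw [split, split, rest]
      have := (sq_add_sq_le_of_balanced (e4 j) (e5 j).1 (e5 j).2).1
      omega
    · rw [split, split, rest]
      have := (sq_add_sq_le_of_balanced (e4 i) (e5 i).1 (e5 i).2).2 hlt
      omega
  exact absurd (hc c' (Finset.mem_univ _)) (not_le.2 hlt')

/-- One `m`-th of a finite set, balanced with respect to a partition and a chain of two
partitions. -/
theorem exists_balanced_subset {α U P C : Type*} [Fintype α] [DecidableEq α]
    [DecidableEq U] [DecidableEq P] [DecidableEq C]
    (f : α → U) (p : α → P) (q : P → C) (m : ℕ) [NeZero m] :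
    ∃ s : Finset α,
      (∀ u, m * (s.filter fun x => f x = u).card < (Finset.univ.filter fun x => f x = u).card + m ∧
        (Finset.univ.filter fun x => f x = u).card < m * (s.filter fun x => f x = u).card + m) ∧
      (∀ u, m * (s.filter fun x => p x = u).card < (Finset.univ.filter fun x => p x = u).card + m) ∧
      (∀ u, m * (s.filter fun x => q (p x) = u).card <
          (Finset.univ.filter fun x => q (p x) = u).card + m ∧
        (Finset.univ.filter fun x => q (p x) = u).card <
          m * (s.filter fun x => q (p x) = u).card + m) := by
  -- Fibres are indexed by their elements, so the family is finite although the codomains need not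
  -- be; empty fibres are treated separately.
  let F : α ⊕ α ⊕ α → Finset α := Sum.elim (fun u => Finset.univ.filter fun x => f x = f u)
    (Sum.elim (fun u => Finset.univ.filter fun x => p x = p u)
      (fun u => Finset.univ.filter fun x => q (p x) = q (p u)))
  obtain ⟨c, hc⟩ := exists_balanced_coloring F (by
    intro s
    obtain ⟨χ, hχ⟩ := exists_balanced_bool f p q s
    refine ⟨χ, fun b i => ?_⟩
    have e : ∀ Q : α → Prop, ∀ [DecidablePred Q], (Finset.univ.filter Q) ∩ s = s.filter Q := by
      intro Q _; ext x; simp [and_comm]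
    obtain ⟨h1, h2, h3⟩ := hχ b
    rcases i with u | u | u
    · simp only [F, Sum.elim_inl, e]; exact h1 (f u)
    · simp only [F, Sum.elim_inl, Sum.elim_inr, e]; exact h2 (p u)
    · simp only [F, Sum.elim_inr, e]; exact h3 (q (p u))) m
  have key : ∀ i, m * ((F i).filter fun x => c x = 0).card < (F i).card + m ∧
      (F i).card < m * ((F i).filter fun x => c x = 0).card + m := by
    intro i
    have hsum : (F i).card = ∑ t, ((F i).filter fun x => c x = t).card :=
      Finset.card_eq_sum_card_fiberwise (fun x _ => Finset.mem_univ (c x))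
    have hconst : ∀ a : ℕ, m * a + m = ∑ t : Fin m, (a + 1) := by
      intro a; simp [mul_add]
    constructor
    · rw [hsum]
      have : m * ((F i).filter fun x => c x = 0).card =
          ∑ t : Fin m, ((F i).filter fun x => c x = 0).card := by simp
      have h2 : ∑ t, ((F i).filter fun x => c x = t).card + m =
          ∑ t, (((F i).filter fun x => c x = t).card + 1) := by
        rw [Finset.sum_add_distrib]; simp
      rw [this, h2]
      -- Strictness comes from comparing colour `0` with itself; it is what makes the share a floor
      -- or a ceiling.
      exact Finset.sum_lt_sum (fun t _ => hc i 0 t) ⟨0, Finset.mem_univ _, Nat.lt_succ_self _⟩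
    · rw [hsum, hconst]
      exact Finset.sum_lt_sum (fun t _ => hc i t 0) ⟨0, Finset.mem_univ _, Nat.lt_succ_self _⟩
  have e : ∀ Q : α → Prop, ∀ [DecidablePred Q], ((Finset.univ.filter fun x => c x = 0).filter Q) =
      (Finset.univ.filter Q).filter fun x => c x = 0 := by
    intro Q _; ext x; simp [and_comm]
  have key' : ∀ Q : α → Prop, ∀ [DecidablePred Q],
      (∀ x, Q x → ∃ i, F i = Finset.univ.filter Q) →
      m * ((Finset.univ.filter fun x => c x = 0).filter Q).card <
        (Finset.univ.filter Q).card + m ∧ (Finset.univ.filter Q).card <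
          m * ((Finset.univ.filter fun x => c x = 0).filter Q).card + m := by
    intro Q _ hQ
    rw [e]
    by_cases hne : ∃ x, Q x
    · obtain ⟨x, hx⟩ := hne
      obtain ⟨i, hi⟩ := hQ x hx
      rw [← hi]
      exact key i
    · have : Finset.univ.filter Q = ∅ := by
        ext x; simpa using fun hx => hne ⟨x, hx⟩
      simp [this, Nat.pos_of_ne_zero (NeZero.ne m)]
  refine ⟨Finset.univ.filter fun x => c x = 0, fun u => key' _ ?_, fun u => (key' _ ?_).1,
    fun u => key' _ ?_⟩
  · rintro x rfl; exact ⟨Sum.inl x, rfl⟩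
  · rintro x rfl; exact ⟨Sum.inr (Sum.inl x), rfl⟩
  · rintro x rfl; exact ⟨Sum.inr (Sum.inr x), rfl⟩

/-- One `m`-th of a matrix of natural numbers, with balanced column sums, row sums, and sums over
the classes of a partition of each row. -/
theorem exists_balanced_matrix {k : ℕ} (n : ℕ) (d φ : Fin k → ℕ → ℕ) (m : ℕ) [NeZero m] :
    ∃ y : Fin k → ℕ → ℕ, (∀ i, ∀ u < n, y i u ≤ d i u) ∧
      (∀ u < n, m * ∑ i, y i u < ∑ i, d i u + m ∧ ∑ i, d i u < m * ∑ i, y i u + m) ∧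
      (∀ i c, m * ∑ u ∈ (Finset.range n).filter (fun u => φ i u = c), y i u <
        ∑ u ∈ (Finset.range n).filter (fun u => φ i u = c), d i u + m) ∧
      (∀ i, m * ∑ u ∈ Finset.range n, y i u < ∑ u ∈ Finset.range n, d i u + m ∧
        ∑ u ∈ Finset.range n, d i u < m * ∑ u ∈ Finset.range n, y i u + m) := by
  let α := Σ i : Fin k, Σ u : Fin n, Fin (d i u)
  -- Each entry is split into units. Columns form the single partition; pairs (row, label), refining
  -- rows, form the chain.
  obtain ⟨s, h1, h2, h3⟩ := exists_balanced_subset (α := α) (fun x => (x.2.1 : ℕ))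
    (fun x => (x.1, φ x.1 x.2.1)) Prod.fst m
  let Y : Finset α → Fin k → ℕ → ℕ := fun s i u => (s.filter fun x => x.1 = i ∧ (x.2.1 : ℕ) = u).card
  have hY : ∀ i, ∀ u < n, Y Finset.univ i u = d i u := by
    intro i u hu
    have : (Finset.univ.filter fun x : α => x.1 = i ∧ (x.2.1 : ℕ) = u) =
        (Finset.univ : Finset (Fin (d i u))).map
          ⟨fun j => (⟨i, ⟨u, hu⟩, j⟩ : α), fun a b hab => by simpa using hab⟩ := by
      ext ⟨i', ⟨u', hu'⟩, j⟩
      simp only [Finset.mem_filter, Finset.mem_univ, true_and, Finset.mem_map]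
      constructor
      · rintro ⟨rfl, rfl⟩
        exact ⟨j, rfl⟩
      · rintro ⟨j', hj'⟩
        exact ⟨(congrArg (fun x : α => x.1) hj').symm,
          (congrArg (fun x : α => (x.2.1 : ℕ)) hj').symm⟩
    simp only [Y]
    rw [this]
    simp
  have c1 : ∀ (t : Finset α) u, ∑ i, Y t i u = (t.filter fun x => (x.2.1 : ℕ) = u).card := by
    intro t u
    rw [Finset.card_eq_sum_card_fiberwise (f := fun x => x.1) (t := Finset.univ)
      (fun x _ => Finset.mem_univ _)]
    refine Finset.sum_congr rfl fun i _ => ?_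
    simp only [Y, Finset.filter_filter, and_comm]
  have c2 : ∀ (t : Finset α) i c, ∑ u ∈ (Finset.range n).filter (fun u => φ i u = c), Y t i u =
      (t.filter fun x => (x.1, φ x.1 x.2.1) = (i, c)).card := by
    intro t i c
    rw [Finset.card_eq_sum_card_fiberwise (f := fun x : α => (x.2.1 : ℕ))
      (t := (Finset.range n).filter (fun u => φ i u = c))]
    · refine Finset.sum_congr rfl fun u hu => ?_
      simp only [Finset.mem_filter] at hu
      simp only [Y, Finset.filter_filter, Prod.mk.injEq]
      congr 1
      ext x
      simp only [Finset.mem_filter]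
      constructor
      · rintro ⟨h, rfl, rfl⟩; exact ⟨h, ⟨rfl, hu.2⟩, rfl⟩
      · rintro ⟨h, ⟨rfl, -⟩, rfl⟩; exact ⟨h, rfl, rfl⟩
    · intro x hx
      simp only [Finset.coe_filter, Set.mem_ofPred_eq, Prod.mk.injEq] at hx
      obtain ⟨-, rfl, hx⟩ := hx
      simp [hx]
  have c3 : ∀ (t : Finset α) i, ∑ u ∈ Finset.range n, Y t i u =
      (t.filter fun x => x.1 = i).card := by
    intro t i
    rw [Finset.card_eq_sum_card_fiberwise (f := fun x : α => (x.2.1 : ℕ)) (t := Finset.range n)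
      (fun x _ => by simp)]
    simp only [Y, Finset.filter_filter]
  refine ⟨Y s, ?_, ?_, ?_, ?_⟩
  · intro i u hu
    rw [← hY i u hu]
    exact Finset.card_le_card (Finset.filter_subset_filter _ (Finset.subset_univ _))
  · intro u hu
    have := h1 u
    rw [← c1, ← c1, Finset.sum_congr rfl fun i _ => hY i u hu] at this
    exact this
  · intro i c
    have := h2 (i, c)
    rw [← c2, ← c2, Finset.sum_congr rfl fun u hu => hY i u
      (Finset.mem_range.1 (Finset.mem_filter.1 hu).1)] at this
    exact this
  · intro i
    rw [← Finset.sum_congr rfl fun u hu => hY i u (Finset.mem_range.1 hu), c3, c3]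
    exact h3 i

/-! ### Edge multiplicities and the addition of one vertex -/

open Finset in
/-- The number of edges that have to be added at the vertex `x` to a graph on `{0, ..., n - 1}` with
edge multiplicities `M` in order to give it degree two. -/
def deficiency (M : ℕ → ℕ → ℕ) (n x : ℕ) : ℕ := 2 - ∑ y ∈ range n, M x y

/-- Adjacency in the graph on `{0, ..., n - 1}` with edge multiplicities `M`. -/
def AdjBelow (M : ℕ → ℕ → ℕ) (n a b : ℕ) : Prop := a < n ∧ b < n ∧ 0 < M a b

/-- `φ` labels the vertices of the graph on `{0, ..., n - 1}` with edge multiplicities `M` in such a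
way that each label class is connected and has total deficiency two. -/
structure IsPathLabelling (M : ℕ → ℕ → ℕ) (n : ℕ) (φ : ℕ → ℕ) : Prop where
  lt : ∀ x < n, φ x < n
  sum : ∀ x < n, ∑ y ∈ (Finset.range n).filter (fun y => φ y = φ x), deficiency M n y = 2
  conn : ∀ x < n, ∀ y < n, φ x = φ y → Relation.ReflTransGen (AdjBelow M n) x y

/-- The edge multiplicities `M i` of the colour classes of a decomposition of the complete multigraph
on `{0, ..., n - 1}` which satisfies the conditions for being extended by `m` vertices.  The classes
in `R` are disjoint unions of paths if `m` is positive, and connected if `m` is zero. -/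
structure IsExtendable {k : ℕ} (lam m n : ℕ) (R : Set (Fin k)) (M : Fin k → ℕ → ℕ → ℕ) : Prop where
  symm : ∀ i x y, M i x y = M i y x
  diag : ∀ i x, M i x x = 0
  sum : ∀ x < n, ∀ y < n, x ≠ y → ∑ i, M i x y = lam
  deg : ∀ i, ∀ x < n, ∑ y ∈ Finset.range n, M i x y ≤ 2
  even : ∀ i, Even (∑ x ∈ Finset.range n, deficiency (M i) n x)
  total : ∀ i, ∑ x ∈ Finset.range n, deficiency (M i) n x ≤ 2 * m
  label : ∀ i ∈ R, 0 < m → ∃ φ, IsPathLabelling (M i) n φ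
  conn : ∀ i ∈ R, m = 0 → ∀ x < n, ∀ y < n, Relation.ReflTransGen (AdjBelow (M i) n) x y

/-- Edge multiplicities after adding the vertex `n`, joined to `u` by `Y u` edges. -/
def addVertex (M : ℕ → ℕ → ℕ) (n : ℕ) (Y : ℕ → ℕ) (x y : ℕ) : ℕ :=
  if x = n then (if y = n then 0 else Y y) else if y = n then Y x else M x y

section addVertex

open Finset

variable {M : ℕ → ℕ → ℕ} {n : ℕ} {Y : ℕ → ℕ}

theorem addVertex_of_lt {x y : ℕ} (hx : x < n) (hy : y < n) : addVertex M n Y x y = M x y := by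
  simp [addVertex, hx.ne, hy.ne]

theorem addVertex_self_right {x : ℕ} (hx : x < n) : addVertex M n Y x n = Y x := by
  simp [addVertex, hx.ne]

theorem addVertex_self_left {x : ℕ} (hx : x < n) : addVertex M n Y n x = Y x := by
  simp [addVertex, hx.ne]

theorem addVertex_comm (hM : ∀ x y, M x y = M y x) (x y : ℕ) :
    addVertex M n Y x y = addVertex M n Y y x := by
  unfold addVertex
  split_ifs <;> first | rfl | exact hM x y

theorem sum_addVertex_of_lt {x : ℕ} (hx : x < n) :
    ∑ y ∈ range (n + 1), addVertex M n Y x y = ∑ y ∈ range n, M x y + Y x := by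
  rw [sum_range_succ, addVertex_self_right hx]
  congr 1
  exact sum_congr rfl fun y hy => addVertex_of_lt hx (mem_range.1 hy)

theorem sum_addVertex_self :
    ∑ y ∈ range (n + 1), addVertex M n Y n y = ∑ y ∈ range n, Y y := by
  rw [sum_range_succ]
  have : addVertex M n Y n n = 0 := by simp [addVertex]
  rw [this, add_zero]
  exact sum_congr rfl fun y hy => addVertex_self_left (mem_range.1 hy)

theorem deficiency_addVertex_of_lt {x : ℕ} (hx : x < n) :
    deficiency (addVertex M n Y) (n + 1) x = deficiency M n x - Y x := by
  rw [deficiency, sum_addVertex_of_lt hx, deficiency]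
  omega

theorem deficiency_addVertex_self :
    deficiency (addVertex M n Y) (n + 1) n = 2 - ∑ y ∈ range n, Y y := by
  rw [deficiency, sum_addVertex_self]

theorem reflTransGen_addVertex {x y : ℕ} (h : Relation.ReflTransGen (AdjBelow M n) x y) :
    Relation.ReflTransGen (AdjBelow (addVertex M n Y) (n + 1)) x y :=
  Relation.ReflTransGen.mono (fun a b ⟨ha, hb, hab⟩ => ⟨ha.trans n.lt_succ_self,
    hb.trans n.lt_succ_self, by rwa [addVertex_of_lt ha hb]⟩) _ _ h

theorem reflTransGen_addVertex_self {x u : ℕ} (hu : u < n) (hY : 0 < Y u)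
    (h : Relation.ReflTransGen (AdjBelow M n) x u) :
    Relation.ReflTransGen (AdjBelow (addVertex M n Y) (n + 1)) x n :=
  (reflTransGen_addVertex h).tail ⟨hu.trans n.lt_succ_self, n.lt_succ_self, by
    rwa [addVertex_self_right hu]⟩

theorem reflTransGen_adjBelow_symm (hM : ∀ x y, M x y = M y x) {x y : ℕ}
    (h : Relation.ReflTransGen (AdjBelow M n) x y) :
    Relation.ReflTransGen (AdjBelow M n) y x :=
  have : Std.Symm (AdjBelow M n) := ⟨fun a b ⟨ha, hb, hab⟩ => ⟨hb, ha, by rwa [hM]⟩⟩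
  Relation.ReflTransGen.stdSymm.symm _ _ h

/-- If the new vertex is joined to at most one of the ends of each path and to at most two ends in
total, then the new graph is again a disjoint union of paths. -/
theorem IsPathLabelling.addVertex {φ : ℕ → ℕ} (hM : ∀ x y, M x y = M y x)
    (hφ : IsPathLabelling M n φ) (hY : ∀ u < n, Y u ≤ deficiency M n u)
    (hcl : ∀ c, ∑ u ∈ (range n).filter (fun u => φ u = c), Y u ≤ 1)
    (htot : ∑ u ∈ range n, Y u ≤ 2) :
    ∃ ψ, IsPathLabelling (addVertex M n Y) (n + 1) ψ := by
  classical
  let s : ℕ → ℕ := fun c => ∑ u ∈ (range n).filter (fun u => φ u = c), Y u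
  -- The paths met by the new vertex merge with it into one class, labelled `n`, a value that `φ`
  -- does not take on the old vertices.
  let ψ : ℕ → ℕ := fun x => if x = n ∨ 0 < s (φ x) then n else φ x
  have hψn : ψ n = n := by simp [ψ]
  have hψ : ∀ x < n, ψ x = n ↔ 0 < s (φ x) := by
    intro x hx
    have := hφ.lt x hx
    by_cases h : 0 < s (φ x)
    · simp [ψ, h]
    · simp [ψ, h, hx.ne, this.ne]
  have hψ' : ∀ x < n, ψ x ≠ n → ψ x = φ x := by
    intro x hx h
    have := mt (hψ x hx).2 h
    simp [ψ, this, hx.ne]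
  have hY0 : ∀ x < n, ¬ 0 < s (φ x) → Y x = 0 := by
    intro x hx h
    have h0 : s (φ x) = 0 := by omega
    exact (Finset.sum_eq_zero_iff.1 h0) x (by simp [hx])
  have hub : ∀ x < n + 1, ψ x = n →
      Relation.ReflTransGen (AdjBelow (_root_.addVertex M n Y) (n + 1)) x n := by
    intro x hx hxn
    rcases Nat.lt_succ_iff_lt_or_eq.1 hx with h | rfl
    · rw [hψ x h] at hxn
      obtain ⟨u, hu, hu'⟩ : ∃ u ∈ (range n).filter (fun u => φ u = φ x), 0 < Y u := by
        by_contra! hcon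
        exact hxn.ne' (Finset.sum_eq_zero fun u hu => Nat.le_zero.1 (hcon u hu))
      simp only [mem_filter, mem_range] at hu
      exact reflTransGen_addVertex_self hu.1 hu' (hφ.conn x h u hu.1 hu.2.symm)
    · exact Relation.ReflTransGen.refl
  refine ⟨ψ, ⟨?_, ?_, ?_⟩⟩
  · intro x hx
    by_cases h : ψ x = n
    · omega
    · have hxn : x ≠ n := fun h' => h (h' ▸ hψn)
      rw [hψ' x (by omega) h]
      exact (hφ.lt x (by omega)).trans n.lt_succ_self
  · intro x hx
    by_cases h : ψ x = n
    · rw [h, sum_filter, sum_range_succ, if_pos hψn, deficiency_addVertex_self, ← sum_filter]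
      have e1 : ∑ y ∈ (range n).filter (fun y => ψ y = n),
          deficiency (_root_.addVertex M n Y) (n + 1) y + ∑ y ∈ (range n).filter (fun y => ψ y = n),
            Y y = ∑ y ∈ (range n).filter (fun y => ψ y = n), deficiency M n y := by
        rw [← sum_add_distrib]
        refine sum_congr rfl fun y hy => ?_
        simp only [mem_filter, mem_range] at hy
        rw [deficiency_addVertex_of_lt hy.1, Nat.sub_add_cancel (hY y hy.1)]
      have e2 : ∑ y ∈ (range n).filter (fun y => ψ y = n), Y y = ∑ y ∈ range n, Y y := by
        rw [sum_filter]
        refine sum_congr rfl fun y hy => ?_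
        split_ifs with hy'
        · rfl
        · rw [hψ y (mem_range.1 hy)] at hy'
          exact (hY0 y (mem_range.1 hy) hy').symm
      -- Each merged path had deficiency 2 and receives exactly one edge. With `j` new edges the
      -- merged class keeps `j` at old vertices and `2 - j` at the new one, in total 2.
      have e3 : ∑ y ∈ (range n).filter (fun y => ψ y = n), deficiency M n y =
          2 * ∑ y ∈ (range n).filter (fun y => ψ y = n), Y y := by
        have hmaps : ∀ y ∈ (range n).filter (fun y => ψ y = n), φ y ∈ range n := by
          intro y hy
          simp only [mem_filter, mem_range] at hy ⊢
          exact hφ.lt y hy.1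
        rw [← sum_fiberwise_of_maps_to hmaps, ← sum_fiberwise_of_maps_to hmaps, mul_sum]
        refine sum_congr rfl fun c _ => ?_
        rw [filter_filter]
        by_cases hc : 0 < s c
        · have hf : (range n).filter (fun y => ψ y = n ∧ φ y = c) =
              (range n).filter (fun y => φ y = c) := by
            ext y
            simp only [mem_filter, mem_range]
            constructor
            · rintro ⟨h1, -, h2⟩; exact ⟨h1, h2⟩
            · rintro ⟨h1, h2⟩; exact ⟨h1, (hψ y h1).2 (h2 ▸ hc), h2⟩
          rw [hf]
          obtain ⟨y, hy⟩ : ((range n).filter (fun y => φ y = c)).Nonempty := by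
            by_contra hne
            rw [not_nonempty_iff_eq_empty] at hne
            simp [s, hne] at hc
          simp only [mem_filter, mem_range] at hy
          have h1 := hφ.sum y hy.1
          rw [hy.2] at h1
          have h2 : s c = 1 := le_antisymm (hcl c) hc
          simp only [s] at h2
          rw [h1, h2, mul_one]
        · have hf : (range n).filter (fun y => ψ y = n ∧ φ y = c) = ∅ := by
            ext y
            simp only [mem_filter, mem_range, notMem_empty, iff_false]
            rintro ⟨h1, h2, rfl⟩
            exact hc ((hψ y h1).1 h2)
          simp [hf]
      omega
    · have hxn : x ≠ n := fun h' => h (h' ▸ hψn)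
      have hx' : x < n := by omega
      rw [sum_filter, sum_range_succ, if_neg (by rw [hψn]; exact Ne.symm h), add_zero,
        ← sum_filter, ← hφ.sum x hx']
      have hs := mt (hψ x hx').2 h
      have hf : (range n).filter (fun y => ψ y = ψ x) = (range n).filter (fun y => φ y = φ x) := by
        ext y
        simp only [mem_filter, mem_range, and_congr_right_iff]
        intro hy
        rw [hψ' x hx' h]
        constructor
        · intro hyx
          rw [← hψ' y hy (by rw [hyx]; exact (hφ.lt x hx').ne), hyx]
        · intro hyx
          rw [hψ' y hy (fun h' => hs (hyx ▸ (hψ y hy).1 h')), hyx]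
      rw [hf]
      refine sum_congr rfl fun y hy => ?_
      simp only [mem_filter, mem_range] at hy
      rw [deficiency_addVertex_of_lt hy.1, hY0 y hy.1 (by rwa [hy.2]), Nat.sub_zero]
  · intro x hx y hy hxy
    by_cases h : ψ x = n
    · exact (hub x hx h).trans (reflTransGen_adjBelow_symm (addVertex_comm hM)
        (hub y hy (hxy ▸ h)))
    · have hxn : x ≠ n := fun h' => h (h' ▸ hψn)
      have hyn : y ≠ n := fun h' => h (by rw [hxy, h', hψn])
      refine reflTransGen_addVertex (hφ.conn x (by omega) y (by omega) ?_)
      rw [← hψ' x (by omega) h, hxy, hψ' y (by omega) (hxy ▸ h)]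

/-- If the new vertex is joined to both ends of a path, then the new graph is connected. -/
theorem IsPathLabelling.connected_addVertex {φ : ℕ → ℕ} (hM : ∀ x y, M x y = M y x)
    (hφ : IsPathLabelling M n φ) (htot : ∑ u ∈ range n, deficiency M n u ≤ 2)
    (hY : 0 < ∑ u ∈ range n, Y u) (x : ℕ) (hx : x < n + 1) (y : ℕ) (hy : y < n + 1) :
    Relation.ReflTransGen (AdjBelow (_root_.addVertex M n Y) (n + 1)) x y := by
  -- Two different classes would already have total deficiency 4, so there is only one path.
  have same : ∀ x < n, ∀ y < n, φ x = φ y := by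
    intro x hx y hy
    by_contra hne
    have hd : Disjoint ((range n).filter fun z => φ z = φ x)
        ((range n).filter fun z => φ z = φ y) := by
      rw [disjoint_filter]
      intro z _ h1 h2
      exact hne (h1.symm.trans h2)
    have h1 := sum_union (f := fun u => deficiency M n u) hd
    have h2 := sum_le_sum_of_subset (f := fun u => deficiency M n u)
      (union_subset (filter_subset (fun z => φ z = φ x) (range n))
        (filter_subset (fun z => φ z = φ y) (range n)))
    rw [h1, hφ.sum x hx, hφ.sum y hy] at h2
    omega
  obtain ⟨u, hu, hu'⟩ : ∃ u ∈ range n, 0 < Y u := by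
    by_contra! hcon
    exact hY.ne' (sum_eq_zero fun u hu => Nat.le_zero.1 (hcon u hu))
  rw [mem_range] at hu
  have hub : ∀ z < n + 1,
      Relation.ReflTransGen (AdjBelow (_root_.addVertex M n Y) (n + 1)) z n := by
    intro z hz
    rcases Nat.lt_succ_iff_lt_or_eq.1 hz with h | rfl
    · exact reflTransGen_addVertex_self hu hu' (hφ.conn z h u hu (same z h u hu))
    · exact Relation.ReflTransGen.refl
  exact (hub x hx).trans (reflTransGen_adjBelow_symm (addVertex_comm hM) (hub y hy))

end addVertex

/-! ### Induction on the number of missing vertices -/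

namespace IsExtendable

open Finset

variable {k lam m n : ℕ} {R : Set (Fin k)} {M : Fin k → ℕ → ℕ → ℕ}

/-- The vertex needs `2 * k` edge ends over all classes and already has `lam * (n - 1)`. -/
theorem sum_deficiency (h : IsExtendable lam m n R M) (hk : 2 * k = lam * (n + m - 1)) (x : ℕ)
    (hx : x < n) : ∑ i, deficiency (M i) n x = lam * m := by
  have h1 : ∑ i, deficiency (M i) n x + ∑ i, ∑ y ∈ range n, M i x y = 2 * k := by
    have h2 : ∀ i, deficiency (M i) n x + ∑ y ∈ range n, M i x y = 2 :=
      fun i => Nat.sub_add_cancel (h.deg i x hx)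
    rw [← sum_add_distrib, sum_congr rfl fun i _ => h2 i]
    simp [mul_comm]
  have h2 : ∑ i, ∑ y ∈ range n, M i x y = lam * (n - 1) := by
    rw [sum_comm, ← add_sum_erase _ _ (mem_range.2 hx)]
    simp only [h.diag, sum_const_zero, zero_add]
    rw [sum_congr rfl (g := fun _ => lam)]
    · simp [card_erase_of_mem, hx, mul_comm]
    · intro y hy
      simp only [mem_erase, mem_range] at hy
      exact h.sum x hx y hy.2 (Ne.symm hy.1)
  have h3 : lam * (n + m - 1) = lam * m + lam * (n - 1) := by
    rw [← mul_add]; congr 1; omega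
  omega

/-- The inductive step: the new vertex takes a balanced `(m + 1)`-st part of the deficiency matrix,
whose rows are colour classes and whose columns are old vertices. -/
theorem exists_addVertex (h : IsExtendable lam (m + 1) n R M) (hk : 2 * k = lam * (n + m)) :
    ∃ M' : Fin k → ℕ → ℕ → ℕ, IsExtendable lam m (n + 1) R M' ∧
      ∀ i, ∀ x < n, ∀ y < n, M' i x y = M i x y := by
  have hlab : ∀ i, ∃ φ, i ∈ R → IsPathLabelling (M i) n φ := by
    intro i
    by_cases hi : i ∈ R
    · obtain ⟨φ, hφ⟩ := h.label i hi m.succ_pos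
      exact ⟨φ, fun _ => hφ⟩
    · exact ⟨id, fun h' => absurd h' hi⟩
  choose φ hφ using hlab
  obtain ⟨Y, y1, y2, y3, y4⟩ := exists_balanced_matrix n (fun i => deficiency (M i) n) φ (m + 1)
  have hdef := h.sum_deficiency hk
  have hcol : ∀ u < n, ∑ i, Y i u = lam := by
    intro u hu
    obtain ⟨h1, h2⟩ := y2 u hu
    rw [hdef u hu] at h1 h2
    have h3 : (m + 1) * ∑ i, Y i u < (m + 1) * (lam + 1) := by linarith
    have h4 : (m + 1) * lam < (m + 1) * (∑ i, Y i u + 1) := by linarith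
    have := Nat.lt_of_mul_lt_mul_left h3
    have := Nat.lt_of_mul_lt_mul_left h4
    omega
  have htwo : ∀ i, ∑ u ∈ range n, Y i u ≤ 2 := by
    intro i
    have h1 := (y4 i).1
    have h2 := h.total i
    have h3 : (m + 1) * ∑ u ∈ range n, Y i u < (m + 1) * 3 := by linarith
    have := Nat.lt_of_mul_lt_mul_left h3
    omega
  -- For the last vertex, the class totals are at most 2 and average to 2, since together they give
  -- `lam * n = 2 * k`.
  have hlast : m = 0 → ∀ i, ∑ u ∈ range n, deficiency (M i) n u = 2 := by
    rintro rfl i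
    have h1 : ∑ i, ∑ u ∈ range n, deficiency (M i) n u = ∑ i : Fin k, 2 := by
      rw [sum_comm, sum_congr rfl fun u hu => hdef u (mem_range.1 hu)]
      simp only [sum_const, card_range, card_univ, Fintype.card_fin, smul_eq_mul]
      linarith
    exact (sum_eq_sum_iff_of_le fun i _ => h.total i).1 h1 i (mem_univ i)
  have hjlast : m = 0 → ∀ i, ∑ u ∈ range n, Y i u = 2 := by
    intro hm i
    have h1 := (y4 i).2
    rw [hlast hm i, hm] at h1
    have := htwo i
    omega
  have hsum : ∀ i, ∑ x ∈ range (n + 1), deficiency (addVertex (M i) n (Y i)) (n + 1) x +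
      2 * ∑ u ∈ range n, Y i u = ∑ x ∈ range n, deficiency (M i) n x + 2 := by
    intro i
    rw [sum_range_succ, deficiency_addVertex_self]
    have e1 : ∑ x ∈ range n, deficiency (addVertex (M i) n (Y i)) (n + 1) x +
        ∑ u ∈ range n, Y i u = ∑ x ∈ range n, deficiency (M i) n x := by
      rw [← sum_add_distrib]
      refine sum_congr rfl fun x hx => ?_
      rw [deficiency_addVertex_of_lt (mem_range.1 hx), Nat.sub_add_cancel (y1 i x (mem_range.1 hx))]
    have := htwo i
    omega
  refine ⟨fun i => addVertex (M i) n (Y i), ⟨?_, ?_, ?_, ?_, ?_, ?_, ?_, ?_⟩,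
    fun i x hx y hy => addVertex_of_lt hx hy⟩
  · exact fun i => addVertex_comm (h.symm i)
  · intro i x
    by_cases hx : x = n <;> simp [addVertex, hx, h.diag]
  · intro x hx y hy hxy
    rcases Nat.lt_succ_iff_lt_or_eq.1 hx with hx | rfl
    · rcases Nat.lt_succ_iff_lt_or_eq.1 hy with hy | rfl
      · simp only [addVertex_of_lt hx hy]
        exact h.sum x hx y hy hxy
      · simp only [addVertex_self_right hx]
        exact hcol x hx
    · have hy : y < x := by omega
      simp only [addVertex_self_left hy]
      exact hcol y hy
  · intro i x hx
    rcases Nat.lt_succ_iff_lt_or_eq.1 hx with hx | rfl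
    · rw [sum_addVertex_of_lt hx]
      have := h.deg i x hx
      have := y1 i x hx
      simp only [deficiency] at this
      omega
    · rw [sum_addVertex_self]
      exact htwo i
  · intro i
    have := h.even i
    have := hsum i
    grind
  · intro i
    have h1 := hsum i
    have h2 := h.total i
    obtain ⟨c, hc⟩ := h.even i
    have h3 := (y4 i).2
    -- With `j` new edges the total changes by `2 - 2 * j`. The case `j = 2` is immediate. If `j =
    -- 1`, balance excludes the old total `2 * (m + 1)`, and evenness then gives at most `2 * m`. If
    -- `j = 0`, balance forces the old total to be at most `m`, and evenness settles `m = 1`.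
    rcases Nat.eq_zero_or_pos m with hm | hm
    · have := hlast hm i
      have := hjlast hm i
      omega
    · have := htwo i
      interval_cases hj : ∑ u ∈ range n, Y i u <;> omega
  · intro i hi hm
    refine (hφ i hi).addVertex (h.symm i) (y1 i) (fun c => ?_) (htwo i)
    by_cases hc : ((range n).filter (fun u => φ i u = c)).Nonempty
    · obtain ⟨x, hx⟩ := hc
      simp only [mem_filter, mem_range] at hx
      have h1 := y3 i c
      have h2 := (hφ i hi).sum x hx.1
      rw [hx.2] at h2
      rw [h2] at h1
      -- Two edges to one path would need `2 * (m + 1) < 2 + (m + 1)`, which fails for `m > 0`.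
      by_contra! hcon
      have := Nat.mul_le_mul_left (m + 1) hcon
      omega
    · rw [not_nonempty_iff_eq_empty] at hc
      simp [hc]
  · intro i hi hm
    refine (hφ i hi).connected_addVertex (h.symm i) (hlast hm i).le ?_
    rw [hjlast hm i]
    exact two_pos

/-- Add `m` vertices, one at a time. -/
theorem exists_extension {m n : ℕ} {M : Fin k → ℕ → ℕ → ℕ} (h : IsExtendable lam m n R M)
    (hk : 2 * k = lam * (n + m - 1)) :
    ∃ M' : Fin k → ℕ → ℕ → ℕ, IsExtendable lam 0 (n + m) R M' ∧
      ∀ i, ∀ x < n, ∀ y < n, M' i x y = M i x y := by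
  induction m generalizing n M with
  | zero => exact ⟨M, h, fun _ _ _ _ _ => rfl⟩
  | succ m ih =>
    obtain ⟨M₁, h1, h2⟩ := h.exists_addVertex hk
    obtain ⟨M₂, h3, h4⟩ := ih h1 (by rw [hk]; congr 1; omega)
    refine ⟨M₂, by rwa [show n + (m + 1) = n + 1 + m by ring], fun i x hx y hy => ?_⟩
    rw [h4 i x (by omega) y (by omega), h2 i x hx y hy]

end IsExtendable

/-! ### Components and degree counts of paths and cycles -/

namespace Graph

section Components

universe u v

variable {α : Type u} {β : Type v} {G C D : Graph α β}

theorem adj_reflTransGen_symm {x y : α} (h : Relation.ReflTransGen G.Adj x y) :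
    Relation.ReflTransGen G.Adj y x :=
  Relation.ReflTransGen.stdSymm.symm _ _ h

theorem IsClosedSubgraph.reflTransGen (hC : C.IsClosedSubgraph G) {x y : α}
    (hx : x ∈ C.vertexSet) (h : Relation.ReflTransGen G.Adj x y) :
    y ∈ C.vertexSet ∧ Relation.ReflTransGen C.Adj x y := by
  induction h with
  | refl => exact ⟨hx, .refl⟩
  | tail _ hbc ih =>
    exact ⟨(IsClosedSubgraph.mem_iff_of_adj hbc hC).1 ih.1,
      ih.2.tail ((IsClosedSubgraph.adj_congr ih.1 hC).2 hbc)⟩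

/-- The connected component of the vertex `x`. -/
def componentAt (G : Graph α β) (x : α) : Graph α β :=
  G.induce {y | Relation.ReflTransGen G.Adj x y}

theorem isComponentOf_componentAt {x : α} (hx : x ∈ G.vertexSet) :
    (G.componentAt x).IsComponentOf G := by
  have hV : {y | Relation.ReflTransGen G.Adj x y} ⊆ G.vertexSet := by
    intro y hy
    rcases Relation.ReflTransGen.cases_tail hy with rfl | ⟨z, -, hz⟩
    · exact hx
    · exact hz.right_mem
  have hc : (G.componentAt x).IsClosedSubgraph G := by
    refine IsClosedSubgraph.mk' (induce_le hV) ?_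
    rintro e y ⟨z, hz⟩ hy
    exact ⟨y, z, hz, hy, Relation.ReflTransGen.tail hy hz.adj⟩
  refine ⟨hc, ⟨x, Relation.ReflTransGen.refl⟩, fun y hy z hz => ?_⟩
  exact (hc.reflTransGen hy ((adj_reflTransGen_symm hy).trans hz)).2

theorem IsComponentOf.le_of_mem (hC : C.IsComponentOf G) (hD : D.IsComponentOf G) {x : α}
    (hxC : x ∈ C.vertexSet) (hxD : x ∈ D.vertexSet) : C ≤ D := by
  have hV : C.vertexSet ⊆ D.vertexSet := by
    intro y hy
    refine (hD.1.reflTransGen hxD ?_).1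
    exact Relation.ReflTransGen.mono (fun a b h => h.mono hC.1.le) _ _ (hC.2.2 x hxC y hy)
  refine ⟨hV, fun e a b h => ?_⟩
  exact (IsClosedSubgraph.isLink_congr (hV h.left_mem) hD.1).2 (h.mono hC.1.le)

theorem IsComponentOf.eq_of_mem (hC : C.IsComponentOf G) (hD : D.IsComponentOf G) {x : α}
    (hxC : x ∈ C.vertexSet) (hxD : x ∈ D.vertexSet) : C = D :=
  le_antisymm (hC.le_of_mem hD hxC hxD) (hD.le_of_mem hC hxD hxC)

theorem IsComponentOf.incidenceSet_eq (hC : C.IsComponentOf G) {x : α} (hx : x ∈ C.vertexSet) :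
    C.incidenceSet x = G.incidenceSet x := by
  ext e
  exact IsClosedSubgraph.inc_congr hx hC.1

theorem IsComponentOf.componentAt_eq (hC : C.IsComponentOf G) {x : α} (hx : x ∈ C.vertexSet) :
    G.componentAt x = C :=
  (isComponentOf_componentAt (hC.1.vertexSet_mono hx)).eq_of_mem hC Relation.ReflTransGen.refl hx

/-- Degrees in a loopless graph with a parametrisation of its vertices and edges. -/
theorem ncard_incidenceSet_of_param (hloop : ∀ e x, ¬ G.IsLink e x x) {p q : ℕ} {x : Fin p → α}
    {e : Fin q → β} (hx : x.Injective) (he : e.Injective) (hE : G.edgeSet = Set.range e)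
    {a b : Fin q → Fin p} (ha : a.Injective) (hb : b.Injective)
    (hlink : ∀ j, G.IsLink (e j) (x (a j)) (x (b j))) :
    (∀ i, (G.incidenceSet (x i)).ncard ≤ 2) ∧ ∑ i, (G.incidenceSet (x i)).ncard = 2 * q := by
  have hinc : ∀ i j, G.Inc (e j) (x i) ↔ a j = i ∨ b j = i := by
    intro i j
    constructor
    · intro h
      rcases h.eq_or_eq_of_isLink (hlink j) with h | h
      · exact Or.inl (hx h).symm
      · exact Or.inr (hx h).symm
    · rintro (rfl | rfl)
      · exact (hlink j).inc_left
      · exact (hlink j).inc_right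
  have hab : ∀ j, a j ≠ b j := by
    intro j h
    have := hlink j
    rw [h] at this
    exact hloop _ _ this
  -- Looplessness makes the two ends of an edge distinct, so edges starting and edges ending at a
  -- vertex can be counted separately.
  have hset : ∀ i, (G.incidenceSet (x i)).ncard =
      (Finset.univ.filter fun j => a j = i).card + (Finset.univ.filter fun j => b j = i).card := by
    intro i
    have : G.incidenceSet (x i) = e '' ↑(Finset.univ.filter fun j => a j = i ∨ b j = i) := by
      ext f
      simp only [mem_incidenceSet, Set.mem_image, Finset.coe_filter, Finset.mem_univ, true_and,
        Set.mem_ofPred_eq]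
      constructor
      · intro hf
        have hm := hf.edge_mem
        rw [hE] at hm
        obtain ⟨j, rfl⟩ := hm
        exact ⟨j, (hinc i j).1 hf, rfl⟩
      · rintro ⟨j, hj, rfl⟩
        exact (hinc i j).2 hj
    rw [this, Set.ncard_image_of_injective _ he, Set.ncard_coe_finset, Finset.filter_or,
      Finset.card_union_of_disjoint]
    rw [Finset.disjoint_filter]
    intro j _ h1 h2
    exact hab j (h1.trans h2.symm)
  have hone : ∀ c : Fin q → Fin p, c.Injective → ∀ i,
      (Finset.univ.filter fun j => c j = i).card ≤ 1 := by
    intro c hc i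
    rw [Finset.card_le_one]
    intro s hs t ht
    simp only [Finset.mem_filter, Finset.mem_univ, true_and] at hs ht
    exact hc (hs.trans ht.symm)
  have hq : ∀ c : Fin q → Fin p, ∑ i, (Finset.univ.filter fun j => c j = i).card = q := by
    intro c
    rw [← Finset.card_eq_sum_card_fiberwise (fun j _ => Finset.mem_univ (c j))]
    simp
  constructor
  · intro i
    rw [hset]
    have := hone a ha i
    have := hone b hb i
    omega
  · rw [Finset.sum_congr rfl fun i _ => hset i, Finset.sum_add_distrib, hq, hq, two_mul]

/-- `G` has a finite vertex set, on which the degree is at most two, and on which the deficiencies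
from degree two add up to `d`. -/
def HasDeficiency (G : Graph α β) (d : ℕ) : Prop :=
  (∀ x ∈ G.vertexSet, (G.incidenceSet x).ncard ≤ 2) ∧
    ∃ s : Finset α, ↑s = G.vertexSet ∧ ∑ x ∈ s, (2 - (G.incidenceSet x).ncard) = d

theorem hasDeficiency_of_param {p q : ℕ} {x : Fin p → α} (hx : x.Injective)
    (hV : G.vertexSet = Set.range x)
    (h : (∀ i, (G.incidenceSet (x i)).ncard ≤ 2) ∧ ∑ i, (G.incidenceSet (x i)).ncard = 2 * q) :
    G.HasDeficiency (2 * p - 2 * q) := by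
  classical
  refine ⟨?_, Finset.univ.image x, by simp [hV], ?_⟩
  · rw [hV]
    rintro _ ⟨i, rfl⟩
    exact h.1 i
  · rw [Finset.sum_image fun i _ j _ hij => hx hij]
    have h1 : ∑ i, (2 - (G.incidenceSet (x i)).ncard) + ∑ i, (G.incidenceSet (x i)).ncard =
        2 * p := by
      rw [← Finset.sum_add_distrib, Finset.sum_congr rfl fun i _ => Nat.sub_add_cancel (h.1 i)]
      simp [mul_comm]
    have := h.2
    omega

/-- A path has one more vertex than edges. This covers the trivial path, whose only vertex has
deficiency 2. -/
theorem IsPathGraph.hasDeficiency (hloop : ∀ e x, ¬ G.IsLink e x x) (h : G.IsPathGraph) :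
    G.HasDeficiency 2 := by
  obtain ⟨l, x, e, hx, he, hV, hE, hlink⟩ := h
  have := hasDeficiency_of_param hx hV (ncard_incidenceSet_of_param hloop hx he hE
    (Fin.castSucc_injective l) (Fin.succ_injective l) hlink)
  convert this using 1
  omega

theorem IsCycleGraph.hasDeficiency (hloop : ∀ e x, ¬ G.IsLink e x x) (h : G.IsCycleGraph) :
    G.HasDeficiency 0 := by
  obtain ⟨l, x, e, hx, he, hV, hE, hlink⟩ := h
  have := hasDeficiency_of_param hx hV (ncard_incidenceSet_of_param hloop hx he hE
    Function.injective_id (add_left_injective 1) hlink)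
  convert this using 1
  omega

theorem HasDeficiency.ncard_eq (h : G.HasDeficiency 0) {x : α} (hx : x ∈ G.vertexSet) :
    (G.incidenceSet x).ncard = 2 := by
  obtain ⟨h1, s, hs, h2⟩ := h
  rw [← hs] at hx
  have := Finset.sum_eq_zero_iff.1 h2 x hx
  have := h1 x (hs ▸ hx)
  omega

end Components

end Graph

/-! ### From colour classes to edge multiplicities -/

namespace Graph

open Finset

section Multiplicity

variable {lam n : ℕ} {G C : Graph ℕ (Sym2 ℕ × ℕ)}

open Classical in
/-- The number of labels `j < lam` for which the edge `(s(x, y), j)` belongs to `S`. -/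
noncomputable def multiplicity (lam : ℕ) (S : Set (Sym2 ℕ × ℕ)) (x y : ℕ) : ℕ :=
  if x = y then 0 else ((range lam).filter fun j => (s(x, y), j) ∈ S).card

theorem multiplicity_comm (S : Set (Sym2 ℕ × ℕ)) (x y : ℕ) :
    multiplicity lam S x y = multiplicity lam S y x := by
  rw [multiplicity, multiplicity, Sym2.eq_swap, if_congr eq_comm rfl rfl]

theorem multiplicity_self (S : Set (Sym2 ℕ × ℕ)) (x : ℕ) : multiplicity lam S x x = 0 := by
  simp [multiplicity]

theorem multiplicity_mono {S T : Set (Sym2 ℕ × ℕ)} {x y : ℕ}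
    (h : ∀ j, (s(x, y), j) ∈ S → (s(x, y), j) ∈ T) :
    multiplicity lam S x y ≤ multiplicity lam T x y := by
  classical
  unfold multiplicity
  split_ifs
  · exact le_rfl
  · exact card_le_card (monotone_filter_right _ fun j _ => h j)

theorem not_isLink_self (hG : G.IsSpanningSubgraph (completeMultigraph lam n))
    (e : Sym2 ℕ × ℕ) (x : ℕ) : ¬ G.IsLink e x x :=
  fun h => (h.mono hG.le).2.1 rfl

theorem isLink_iff_mem_edgeSet (hG : G.IsSpanningSubgraph (completeMultigraph lam n))
    {e : Sym2 ℕ × ℕ} {x y : ℕ} :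
    G.IsLink e x y ↔ e ∈ G.edgeSet ∧ (completeMultigraph lam n).IsLink e x y :=
  ⟨fun h => ⟨h.edge_mem, h.mono hG.le⟩, fun h => (hG.le.isLink_iff h.1).2 h.2⟩

theorem mem_vertexSet_iff (hG : G.IsSpanningSubgraph (completeMultigraph lam n)) {x : ℕ} :
    x ∈ G.vertexSet ↔ x < n := by
  rw [hG.vertexSet_eq]; rfl

theorem incidenceSet_encard_eq (hG : G.IsSpanningSubgraph (completeMultigraph lam n)) {x : ℕ}
    (hx : x < n) :
    (G.incidenceSet x).encard = ∑ y ∈ range n, multiplicity lam G.edgeSet x y := by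
  classical
  let T := ((range n ×ˢ range lam).filter fun yj => x ≠ yj.1 ∧ (s(x, yj.1), yj.2) ∈ G.edgeSet)
  have hT : G.incidenceSet x = (T.image fun yj => (s(x, yj.1), yj.2) : Finset (Sym2 ℕ × ℕ)) := by
    ext ⟨z, j⟩
    simp only [mem_incidenceSet, coe_image, Set.mem_image, mem_coe, T, mem_filter, mem_product,
      mem_range, Prod.exists, Prod.mk.injEq]
    constructor
    · rintro ⟨y, hy⟩
      obtain ⟨h1, h2, h3, h4, h5⟩ := (isLink_iff_mem_edgeSet hG).1 hy
      refine ⟨y, j, ⟨h5, h3, ?_⟩, h2.symm, rfl⟩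
      rw [← show z = s(x, y) from h2]
      exact h1
    · rintro ⟨y, j, ⟨⟨h1, h2⟩, h3, h4⟩, rfl, rfl⟩
      exact ⟨y, (isLink_iff_mem_edgeSet hG).2 ⟨h4, rfl, h3, hx, h1, h2⟩⟩
  rw [hT, Set.encard_coe_eq_coe_finsetCard, card_image_of_injOn, card_filter, sum_product]
  · congr 1
    refine sum_congr rfl fun y _ => ?_
    by_cases hxy : x = y
    · simp [multiplicity, hxy]
    · simp [multiplicity, hxy]
  · rintro ⟨y, j⟩ _ ⟨y', j'⟩ _ h
    simp only [Prod.mk.injEq, Sym2.congr_right] at h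
    simp [h.1, h.2]

theorem incidenceSet_ncard_eq (hG : G.IsSpanningSubgraph (completeMultigraph lam n)) {x : ℕ}
    (hx : x < n) :
    (G.incidenceSet x).ncard = ∑ y ∈ range n, multiplicity lam G.edgeSet x y := by
  rw [Set.ncard, incidenceSet_encard_eq hG hx, ENat.toNat_natCast]

theorem vertexDegree_eq (hG : G.IsSpanningSubgraph (completeMultigraph lam n)) {x : ℕ}
    (hx : x < n) :
    G.vertexDegree x = ∑ y ∈ range n, multiplicity lam G.edgeSet x y := by
  have : G.loopSet x = ∅ := by
    ext e
    simpa using not_isLink_self hG e x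
  rw [vertexDegree, this, incidenceSet_encard_eq hG hx]
  simp

theorem adjBelow_multiplicity_iff (hG : G.IsSpanningSubgraph (completeMultigraph lam n))
    {x y : ℕ} : AdjBelow (multiplicity lam G.edgeSet) n x y ↔ G.Adj x y := by
  classical
  constructor
  · rintro ⟨hx, hy, h⟩
    have hxy : x ≠ y := by
      rintro rfl
      simp [multiplicity] at h
    simp only [multiplicity, if_neg hxy, card_pos] at h
    obtain ⟨j, hj⟩ := h
    simp only [mem_filter, mem_range] at hj
    exact ⟨_, (isLink_iff_mem_edgeSet hG).2 ⟨hj.2, rfl, hxy, hx, hy, hj.1⟩⟩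
  · rintro ⟨⟨z, j⟩, he⟩
    obtain ⟨h1, h2, h3, h4, h5, h6⟩ := (isLink_iff_mem_edgeSet hG).1 he
    refine ⟨h4, h5, ?_⟩
    rw [multiplicity, if_neg h3, card_pos]
    refine ⟨j, ?_⟩
    rw [mem_filter, mem_range]
    refine ⟨h6, ?_⟩
    rw [← show z = s(x, y) from h2]
    exact h1

theorem reflTransGen_adjBelow_iff (hG : G.IsSpanningSubgraph (completeMultigraph lam n))
    {x y : ℕ} : Relation.ReflTransGen (AdjBelow (multiplicity lam G.edgeSet) n) x y ↔
      Relation.ReflTransGen G.Adj x y := by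
  have : AdjBelow (multiplicity lam G.edgeSet) n = G.Adj := by
    ext x y; exact adjBelow_multiplicity_iff hG
  rw [this]

open Classical in
theorem IsComponentOf.sum_deficiency (hG : G.IsSpanningSubgraph (completeMultigraph lam n))
    (hC : C.IsComponentOf G) {d : ℕ} (hd : C.HasDeficiency d) :
    ∑ x ∈ (range n).filter (fun x => x ∈ C.vertexSet),
      deficiency (multiplicity lam G.edgeSet) n x = d := by
  obtain ⟨-, s, hs, hsum⟩ := hd
  have hsf : (range n).filter (fun x => x ∈ C.vertexSet) = s := by
    ext x
    rw [mem_filter, mem_range, ← hs, mem_coe, and_iff_right_iff_imp]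
    intro hx
    rw [← mem_coe, hs] at hx
    exact (mem_vertexSet_iff hG).1 (hC.1.vertexSet_mono hx)
  rw [hsf, ← hsum]
  refine sum_congr rfl fun x hx => ?_
  rw [← mem_coe, hs] at hx
  rw [deficiency, ← incidenceSet_ncard_eq hG ((mem_vertexSet_iff hG).1 (hC.1.vertexSet_mono hx)),
    hC.incidenceSet_eq hx]

theorem IsSpanningSubgraph.not_isLink_self_of_le
    (hG : G.IsSpanningSubgraph (completeMultigraph lam n)) (hC : C ≤ G) (e : Sym2 ℕ × ℕ) (x : ℕ) :
    ¬ C.IsLink e x x :=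
  fun h => not_isLink_self hG e x (h.mono hC)

theorem IsUnionOfPathsAndCycles.degree_le_two (hG : G.IsSpanningSubgraph (completeMultigraph lam n))
    (h : G.IsUnionOfPathsAndCycles) {x : ℕ} (hx : x < n) :
    ∑ y ∈ range n, multiplicity lam G.edgeSet x y ≤ 2 := by
  have hC := isComponentOf_componentAt ((mem_vertexSet_iff hG).2 hx)
  have hloop := hG.not_isLink_self_of_le hC.1.le
  have hmem : x ∈ (G.componentAt x).vertexSet := Relation.ReflTransGen.refl
  rw [← incidenceSet_ncard_eq hG hx, ← hC.incidenceSet_eq hmem]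
  rcases h _ hC with h | h
  · exact (h.hasDeficiency hloop).1 x hmem
  · exact (h.hasDeficiency hloop).1 x hmem

/-- The total deficiency is twice the number of paths. -/
theorem IsUnionOfPathsAndCycles.exists_encard_pathComponents
    (hG : G.IsSpanningSubgraph (completeMultigraph lam n)) (h : G.IsUnionOfPathsAndCycles) :
    ∃ p : ℕ, G.pathComponents.encard = p ∧
      ∑ x ∈ range n, deficiency (multiplicity lam G.edgeSet) n x = 2 * p := by
  classical
  let S := (range n).image G.componentAt
  refine ⟨(S.filter fun C => C.IsPathGraph).card, ?_, ?_⟩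
  · rw [← Set.encard_coe_eq_coe_finsetCard]
    congr 1
    ext C
    simp only [pathComponents, Set.mem_ofPred_eq, coe_filter, S, mem_image, mem_range]
    refine and_congr_left fun _ => ⟨fun hC => ?_, ?_⟩
    · obtain ⟨x, hx⟩ := hC.2.1
      exact ⟨x, (mem_vertexSet_iff hG).1 (hC.1.vertexSet_mono hx), hC.componentAt_eq hx⟩
    · rintro ⟨x, hx, rfl⟩
      exact isComponentOf_componentAt ((mem_vertexSet_iff hG).2 hx)
  -- Grouped by component, each path contributes 2 and each cycle 0.
  · rw [← sum_fiberwise_of_maps_to (t := S) (g := G.componentAt)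
      fun x hx => mem_image_of_mem _ hx]
    rw [card_filter, mul_sum]
    refine sum_congr rfl fun C hCS => ?_
    obtain ⟨x, hx, rfl⟩ := mem_image.1 hCS
    have hC := isComponentOf_componentAt ((mem_vertexSet_iff hG).2 (mem_range.1 hx))
    have hf : (range n).filter (fun y => G.componentAt y = G.componentAt x) =
        (range n).filter (fun y => y ∈ (G.componentAt x).vertexSet) := by
      ext y
      simp only [mem_filter, and_congr_right_iff]
      intro _
      constructor
      · intro h'
        rw [← h']
        exact Relation.ReflTransGen.refl
      · exact hC.componentAt_eq
    have hloop := hG.not_isLink_self_of_le hC.1.le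
    rw [hf]
    split_ifs with hp
    · rw [hC.sum_deficiency hG (hp.hasDeficiency hloop), mul_one]
    · rw [hC.sum_deficiency hG (((h _ hC).resolve_left hp).hasDeficiency hloop),
        mul_zero]

/-- Every component is a path; its least vertex serves as label. -/
theorem IsCycleFree.exists_isPathLabelling (hG : G.IsSpanningSubgraph (completeMultigraph lam n))
    (h : G.IsUnionOfPathsAndCycles) (hfree : G.IsCycleFree) :
    ∃ φ, IsPathLabelling (multiplicity lam G.edgeSet) n φ := by
  classical
  have hcomp : ∀ x < n, (G.componentAt x).IsComponentOf G := fun x hx =>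
    isComponentOf_componentAt ((mem_vertexSet_iff hG).2 hx)
  let φ : ℕ → ℕ := fun x => sInf (G.componentAt x).vertexSet
  have hφ : ∀ x < n, φ x ∈ (G.componentAt x).vertexSet := fun x hx =>
    Nat.sInf_mem (hcomp x hx).2.1
  have hiff : ∀ x < n, ∀ y < n, φ y = φ x ↔ y ∈ (G.componentAt x).vertexSet := by
    intro x hx y hy
    constructor
    · intro hxy
      have h1 := hφ y hy
      rw [hxy] at h1
      rw [(hcomp x hx).eq_of_mem (hcomp y hy) (hφ x hx) h1]
      exact Relation.ReflTransGen.refl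
    · intro hy'
      simp only [φ, (hcomp x hx).componentAt_eq hy']
  refine ⟨φ, fun x hx => ?_, fun x hx => ?_, fun x hx y hy hxy => ?_⟩
  · exact (mem_vertexSet_iff hG).1 ((hcomp x hx).1.vertexSet_mono (hφ x hx))
  · have hp := (h _ (hcomp x hx)).resolve_right (hfree _ (hcomp x hx).1.le)
    rw [← (hcomp x hx).sum_deficiency hG
      (hp.hasDeficiency (hG.not_isLink_self_of_le (hcomp x hx).1.le))]
    congr 1
    ext y
    simp only [mem_filter, mem_range, and_congr_right_iff]
    exact fun hy => hiff x hx y hy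
  · rw [reflTransGen_adjBelow_iff hG]
    exact (hiff x hx y hy).1 hxy.symm

theorem IsDecomposition.sum_multiplicity {k : ℕ} {A : Fin k → Graph ℕ (Sym2 ℕ × ℕ)}
    (hA : IsDecomposition A (completeMultigraph lam n)) {x y : ℕ} (hx : x < n) (hy : y < n)
    (hxy : x ≠ y) : ∑ i, multiplicity lam (A i).edgeSet x y = lam := by
  classical
  simp only [multiplicity, if_neg hxy, card_filter]
  rw [sum_comm]
  have : ∀ j ∈ range lam, ∑ i, (if (s(x, y), j) ∈ (A i).edgeSet then 1 else 0) = 1 := by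
    intro j hj
    have he : (s(x, y), j) ∈ (completeMultigraph lam n).edgeSet :=
      ⟨x, y, rfl, hxy, hx, hy, mem_range.1 hj⟩
    rw [hA.cover, Set.mem_iUnion] at he
    obtain ⟨i, hi⟩ := he
    rw [sum_eq_single i, if_pos hi]
    · intro i' _ hne
      exact if_neg fun h' => Set.disjoint_left.1 (hA.disjoint i' i hne) h' hi
    · simp
  rw [sum_congr rfl this]
  simp

theorem IsPathDecomposition.isExtendable {k m : ℕ} {A : Fin k → Graph ℕ (Sym2 ℕ × ℕ)}
    (hA : IsPathDecomposition A (completeMultigraph lam n))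
    (hm : ∀ i, (A i).pathComponents.encard ≤ m) :
    IsExtendable lam m n {i | (A i).IsCycleFree} fun i => multiplicity lam (A i).edgeSet := by
  have htotal : ∀ i, ∑ x ∈ range n, deficiency (multiplicity lam (A i).edgeSet) n x ≤ 2 * m := by
    intro i
    obtain ⟨p, hp, hs⟩ := (hA.2 i).exists_encard_pathComponents (hA.1.spanning i)
    have := hm i
    rw [hp, Nat.cast_le] at this
    omega
  have hlab : ∀ i, (A i).IsCycleFree →
      ∃ φ, IsPathLabelling (multiplicity lam (A i).edgeSet) n φ :=
    fun i hi => hi.exists_isPathLabelling (hA.1.spanning i) (hA.2 i)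
  refine ⟨fun i => multiplicity_comm _, fun i => multiplicity_self _,
    fun x hx y hy => hA.1.sum_multiplicity hx hy,
    fun i x hx => (hA.2 i).degree_le_two (hA.1.spanning i) hx, fun i => ?_, htotal,
    fun i hi _ => hlab i hi, ?_⟩
  · obtain ⟨p, -, hs⟩ := (hA.2 i).exists_encard_pathComponents (hA.1.spanning i)
    rw [hs]
    exact even_two_mul p
  -- With `m = 0` there are no path components, so a cycle-free class has no vertices at all and the
  -- claim is vacuous.
  · rintro i hi rfl x hx
    obtain ⟨φ, hφ⟩ := hlab i hi
    have h1 := hφ.sum x hx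
    have h2 := htotal i
    have h3 := sum_le_sum_of_subset (f := deficiency (multiplicity lam (A i).edgeSet) n)
      (filter_subset (fun y => φ y = φ x) (range n))
    omega

end Multiplicity

end Graph

/-! ### Realising multiplicities by graphs, and necessity -/

namespace Graph

open Finset

/-- A set of `lam` labels can be split into parts of prescribed sizes. -/
theorem exists_partition_range {k : ℕ} (lam : ℕ) (c : Fin k → ℕ) (hc : ∑ i, c i = lam) :
    ∃ P : Fin k → Finset ℕ, (∀ i, (P i).card = c i) ∧ (∀ i, P i ⊆ range lam) ∧
      ∀ j < lam, ∃! i, j ∈ P i := by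
  have e : Fin lam ≃ Σ i : Fin k, Fin (c i) := Fintype.equivOfCardEq (by simp [hc])
  refine ⟨fun i => (univ : Finset (Fin (c i))).map
    ⟨fun t => (e.symm ⟨i, t⟩ : ℕ), fun a b hab => ?_⟩, fun i => by simp, fun i j hj => ?_,
    fun j hj => ⟨(e ⟨j, hj⟩).1, ?_, ?_⟩⟩
  · simpa using e.symm.injective (Fin.val_injective hab)
  · obtain ⟨t, -, rfl⟩ := mem_map.1 hj
    exact mem_range.2 (e.symm ⟨i, t⟩).2
  · exact mem_map.2 ⟨(e ⟨j, hj⟩).2, mem_univ _, congrArg Fin.val (e.symm_apply_apply ⟨j, hj⟩)⟩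
  · intro i hi
    obtain ⟨t, -, ht⟩ := mem_map.1 hi
    have : e.symm ⟨i, t⟩ = ⟨j, hj⟩ := Fin.ext ht
    rw [← this, e.apply_symm_apply]

section Extension

variable {k m n lam : ℕ} {A F : Fin k → Graph ℕ (Sym2 ℕ × ℕ)}

/-- Edge multiplicities extending those of a decomposition of the complete multigraph on `n`
vertices are the multiplicities of a decomposition in which it is embedded. -/
theorem IsDecomposition.exists_extension
    (hA : IsDecomposition A (completeMultigraph lam n)) {N : ℕ} (hN : n ≤ N)
    {M : Fin k → ℕ → ℕ → ℕ} (hsymm : ∀ i x y, M i x y = M i y x) (hdiag : ∀ i x, M i x x = 0)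
    (hsum : ∀ x < N, ∀ y < N, x ≠ y → ∑ i, M i x y = lam)
    (hM : ∀ i, ∀ x < n, ∀ y < n, M i x y = multiplicity lam (A i).edgeSet x y) :
    ∃ F : Fin k → Graph ℕ (Sym2 ℕ × ℕ), IsDecomposition F (completeMultigraph lam N) ∧
      IsEmbeddedIn A F ∧
      ∀ i, ∀ x < N, ∀ y < N, multiplicity lam (F i).edgeSet x y = M i x y := by
  classical
  -- The labels are distributed per unordered pair, so that the choice does not depend on the order
  -- of the ends. Old pairs keep their colours; the labels of the other pairs are split arbitrarily
  -- into parts of the right sizes.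
  have hP : ∀ z : Sym2 ℕ, ∃ P : Fin k → Finset ℕ, ∀ x y, z = s(x, y) → x < N → y < N → x ≠ y →
      (∀ i, (P i).card = M i x y) ∧ (∀ i, P i ⊆ range lam) ∧ (∀ j < lam, ∃! i, j ∈ P i) ∧
      (x < n → y < n → ∀ i, P i = (range lam).filter fun j => (z, j) ∈ (A i).edgeSet) := by
    intro z
    induction z using Sym2.ind with
    | _ x y =>
      suffices h : ∃ P : Fin k → Finset ℕ, x < N → y < N → x ≠ y →
          (∀ i, (P i).card = M i x y) ∧ (∀ i, P i ⊆ range lam) ∧ (∀ j < lam, ∃! i, j ∈ P i) ∧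
          (x < n → y < n → ∀ i,
            P i = (range lam).filter fun j => (s(x, y), j) ∈ (A i).edgeSet) by
        obtain ⟨P, hP⟩ := h
        refine ⟨P, fun x' y' hz hx hy hxy => ?_⟩
        rcases Sym2.eq_iff.1 hz with ⟨rfl, rfl⟩ | ⟨rfl, rfl⟩
        · exact hP hx hy hxy
        · obtain ⟨h1, h2, h3, h4⟩ := hP hy hx hxy.symm
          exact ⟨fun i => by rw [h1, hsymm], h2, h3, fun h h' => h4 h' h⟩
      by_cases hxy : x < N ∧ y < N ∧ x ≠ y
      · obtain ⟨hx, hy, hxy⟩ := hxy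
        by_cases hn : x < n ∧ y < n
        · refine ⟨fun i => (range lam).filter fun j => (s(x, y), j) ∈ (A i).edgeSet,
            fun _ _ _ => ⟨fun i => ?_, fun i => filter_subset _ _, fun j hj => ?_,
              fun _ _ _ => rfl⟩⟩
          · rw [hM i x hn.1 y hn.2, multiplicity, if_neg hxy]
          · have he : (s(x, y), j) ∈ (completeMultigraph lam n).edgeSet :=
              ⟨x, y, rfl, hxy, hn.1, hn.2, hj⟩
            rw [hA.cover, Set.mem_iUnion] at he
            obtain ⟨i, hi⟩ := he
            refine ⟨i, by simp [hj, hi], fun i' hi' => ?_⟩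
            by_contra hne
            exact Set.disjoint_left.1 (hA.disjoint i' i hne) (mem_filter.1 hi').2 hi
        · obtain ⟨P, h1, h2, h3⟩ := exists_partition_range lam _ (hsum x hx y hy hxy)
          exact ⟨P, fun _ _ _ => ⟨h1, h2, h3, fun h h' => absurd ⟨h, h'⟩ hn⟩⟩
      · exact ⟨fun _ => ∅, fun h1 h2 h3 => absurd ⟨h1, h2, h3⟩ hxy⟩
  choose P hP using hP
  let G := completeMultigraph lam N
  let E : Fin k → Set (Sym2 ℕ × ℕ) := fun i => {e | e.2 ∈ P e.1 i}
  have hdisj : ∀ i i' e, e ∈ (G.restrict (E i)).edgeSet → e ∈ (G.restrict (E i')).edgeSet →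
      i = i' := by
    rintro i i' e ⟨he, hi⟩ ⟨-, hi'⟩
    obtain ⟨x, y, hz, hxy, hx, hy, hj⟩ := he
    exact ((hP e.1 x y hz hx hy hxy).2.2.1 e.2 hj).unique hi hi'
  refine ⟨fun i => G.restrict (E i), ⟨fun i => ⟨restrict_le, rfl⟩, ?_, ?_⟩, fun i => ⟨?_, ?_⟩, ?_⟩
  · ext e
    rw [Set.mem_iUnion]
    constructor
    · intro he
      obtain ⟨x, y, hz, hxy, hx, hy, hj⟩ := id he
      obtain ⟨i, hi, -⟩ := (hP e.1 x y hz hx hy hxy).2.2.1 e.2 hj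
      exact ⟨i, he, hi⟩
    · rintro ⟨i, he⟩
      exact he.1
  · intro i i' hne
    rw [Set.disjoint_left]
    exact fun e h h' => hne (hdisj i i' e h h')
  · intro x hx
    exact lt_of_lt_of_le ((mem_vertexSet_iff (hA.spanning i)).1 hx) hN
  · rintro ⟨z, j⟩ x y h
    obtain ⟨h1, h2, h3, h4, h5, h6⟩ := (isLink_iff_mem_edgeSet (hA.spanning i)).1 h
    refine ⟨?_, h2, h3, h4.trans_le hN, h5.trans_le hN, h6⟩
    have := (hP z x y h2 (h4.trans_le hN) (h5.trans_le hN) h3).2.2.2 h4 h5 i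
    change j ∈ P z i
    rw [this]
    simp only [mem_filter, mem_range]
    exact ⟨h6, h1⟩
  · intro i x hx y hy
    by_cases hxy : x = y
    · rw [hxy, multiplicity_self, hdiag]
    · obtain ⟨h1, h2, -, -⟩ := hP s(x, y) x y rfl hx hy hxy
      rw [multiplicity, if_neg hxy, ← h1 i]
      congr 1
      ext j
      simp only [mem_filter, mem_range]
      constructor
      · exact fun h => h.2.2
      · intro hj
        have hj' := mem_range.1 (h2 i hj)
        exact ⟨hj', ⟨x, y, rfl, hxy, hx, hy, hj'⟩, hj⟩

theorem isTwoFactorOf_of_isExtendable {R : Set (Fin k)} {M : Fin k → ℕ → ℕ → ℕ}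
    (hM : IsExtendable lam 0 n R M) {i : Fin k} {H : Graph ℕ (Sym2 ℕ × ℕ)}
    (hH : H.IsSpanningSubgraph (completeMultigraph lam n))
    (hmul : ∀ x < n, ∀ y < n, multiplicity lam H.edgeSet x y = M i x y) :
    H.IsTwoFactorOf (completeMultigraph lam n) ∧
      (0 < n → i ∈ R → H.IsHamiltonianCycleOf (completeMultigraph lam n)) := by
  have h2 : H.IsTwoFactorOf (completeMultigraph lam n) := by
    refine ⟨hH, fun x hx => ?_⟩
    have hx' := (mem_vertexSet_iff hH).1 hx
    rw [vertexDegree_eq hH hx',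
      sum_congr rfl fun y hy => hmul x hx' y (mem_range.1 hy)]
    have h1 := hM.deg i x hx'
    have h3 := sum_eq_zero_iff.1 (Nat.le_zero.1 (hM.total i)) x (mem_range.2 hx')
    rw [deficiency] at h3
    have : ∑ y ∈ range n, M i x y = 2 := by omega
    rw [this]
    rfl
  refine ⟨h2, fun hn hi => ⟨h2, ⟨0, (mem_vertexSet_iff hH).2 hn⟩, fun x hx y hy => ?_⟩⟩
  rw [← reflTransGen_adjBelow_iff hH]
  refine Relation.ReflTransGen.mono (fun a b ⟨ha, hb, hab⟩ => ⟨ha, hb, ?_⟩) _ _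
    (hM.conn i hi rfl x ((mem_vertexSet_iff hH).1 hx) y ((mem_vertexSet_iff hH).1 hy))
  rwa [hmul a ha b hb]

theorem IsPathDecomposition.exists_twoFactorization
    (hA : IsPathDecomposition A (completeMultigraph lam n)) (hnm : 1 ≤ n + m)
    (hk : 2 * k = lam * (n + m - 1)) (hm : ∀ i, (A i).pathComponents.encard ≤ m) :
    ∃ F : Fin k → Graph ℕ (Sym2 ℕ × ℕ),
      IsTwoFactorization F (completeMultigraph lam (n + m)) ∧ IsEmbeddedIn A F ∧
      numCycleFree A ≤ numHamiltonian F (completeMultigraph lam (n + m)) := by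
  obtain ⟨M, hM, hMA⟩ := (hA.isExtendable hm).exists_extension hk
  obtain ⟨F, h1, h2, h3⟩ := hA.1.exists_extension (Nat.le_add_right n m) hM.symm hM.diag hM.sum hMA
  have h4 := fun i => isTwoFactorOf_of_isExtendable hM (h1.spanning i) (h3 i)
  exact ⟨F, ⟨h1, fun i => (h4 i).1⟩, h2,
    Set.ncard_le_ncard (fun i hi => (h4 i).2 hnm hi) (Set.toFinite _)⟩

theorem IsTwoFactorOf.sum_multiplicity {H : Graph ℕ (Sym2 ℕ × ℕ)}
    (hH : H.IsTwoFactorOf (completeMultigraph lam n)) {x : ℕ} (hx : x < n) :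
    ∑ y ∈ range n, multiplicity lam H.edgeSet x y = 2 := by
  have := hH.2 x ((mem_vertexSet_iff hH.1).2 hx)
  rw [vertexDegree_eq hH.1 hx] at this
  exact_mod_cast this

theorem IsTwoFactorization.two_mul_eq (hF : IsTwoFactorization F (completeMultigraph lam n))
    (hn : 0 < n) : 2 * k = lam * (n - 1) := by
  have h1 : ∑ i, ∑ y ∈ range n, multiplicity lam (F i).edgeSet 0 y = 2 * k := by
    rw [sum_congr rfl fun i _ => (hF.2 i).sum_multiplicity hn]
    simp [mul_comm]
  rw [← h1, sum_comm, ← add_sum_erase _ _ (mem_range.2 hn)]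
  simp only [multiplicity_self, sum_const_zero, zero_add]
  rw [sum_congr rfl (g := fun _ => lam)]
  · simp [card_erase_of_mem, hn, mul_comm]
  · intro y hy
    simp only [mem_erase, mem_range] at hy
    exact hF.1.sum_multiplicity hn hy.2 (Ne.symm hy.1)

/-- Count the edges of `F i` between old and new vertices. There are at least as many as the total
deficiency of `A i`, twice its number of paths, and at most `2 * m`, since new vertices have degree
2. -/
theorem IsTwoFactorization.encard_pathComponents_le
    (hA : IsPathDecomposition A (completeMultigraph lam n))
    (hF : IsTwoFactorization F (completeMultigraph lam (n + m))) (hAF : IsEmbeddedIn A F)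
    (i : Fin k) : (A i).pathComponents.encard ≤ m := by
  obtain ⟨p, hp, hsum⟩ := (hA.2 i).exists_encard_pathComponents (hA.1.spanning i)
  rw [hp, Nat.cast_le]
  set MA := multiplicity lam (A i).edgeSet with hMA
  set MF := multiplicity lam (F i).edgeSet with hMF
  -- Every edge between old vertices is already coloured by `A`, so `F i` gains none of them.
  have hle : ∀ x < n, ∀ y < n, MF x y ≤ MA x y := by
    intro x hx y hy
    by_cases hxy : x = y
    · rw [hxy, hMF, multiplicity_self]; exact Nat.zero_le _
    refine multiplicity_mono fun j hj => ?_
    obtain ⟨u, v, huv⟩ := exists_isLink_of_mem_edgeSet hj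
    obtain ⟨-, -, -, -, -, h6⟩ := (isLink_iff_mem_edgeSet (hF.1.spanning i)).1 huv
    have he : (s(x, y), j) ∈ (completeMultigraph lam n).edgeSet := ⟨x, y, rfl, hxy, hx, hy, h6⟩
    rw [hA.1.cover, Set.mem_iUnion] at he
    obtain ⟨i', hi'⟩ := he
    by_cases hii : i' = i
    · exact hii ▸ hi'
    · exact absurd hj (Set.disjoint_left.1 (hF.1.disjoint i' i hii)
        ((hAF i').edgeSet_mono hi'))
  have hdef : ∀ x < n, deficiency MA n x ≤ ∑ y ∈ range m, MF x (n + y) := by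
    intro x hx
    have h1 := (hF.2 i).sum_multiplicity (x := x) (by omega)
    rw [sum_range_add, ← hMF] at h1
    have h2 : ∑ y ∈ range n, MF x y ≤ ∑ y ∈ range n, MA x y :=
      sum_le_sum fun y hy => hle x hx y (mem_range.1 hy)
    rw [deficiency]
    omega
  have hout : ∀ y < m, ∑ x ∈ range n, MF x (n + y) ≤ 2 := by
    intro y hy
    rw [← (hF.2 i).sum_multiplicity (x := n + y) (by omega), sum_range_add,
      sum_congr rfl fun x _ => multiplicity_comm (lam := lam) (F i).edgeSet x (n + y)]
    exact Nat.le_add_right _ _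
  have : 2 * p ≤ 2 * m := by
    rw [← hsum]
    calc ∑ x ∈ range n, deficiency MA n x
        ≤ ∑ x ∈ range n, ∑ y ∈ range m, MF x (n + y) :=
          sum_le_sum fun x hx => hdef x (mem_range.1 hx)
      _ = ∑ y ∈ range m, ∑ x ∈ range n, MF x (n + y) := sum_comm
      _ ≤ ∑ y ∈ range m, 2 := sum_le_sum fun y hy => hout y (mem_range.1 hy)
      _ = 2 * m := by simp [mul_comm]
  omega

/-- A colour class that extends to a Hamiltonian cycle on a larger vertex set is cycle-free. -/
theorem IsHamiltonianCycleOf.isCycleFree {H B : Graph ℕ (Sym2 ℕ × ℕ)} {N : ℕ}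
    (hH : H.IsHamiltonianCycleOf (completeMultigraph lam N)) (hBH : B ≤ H)
    {v : ℕ} (hv : v < N) (hvB : v ∉ B.vertexSet) : B.IsCycleFree := by
  intro C hCB hC
  have hCH := hCB.trans hBH
  have hdef := hC.hasDeficiency (hH.1.1.not_isLink_self_of_le hCH)
  -- Both graphs are 2-regular, so the cycle uses all edges of `H` at its vertices; connectedness
  -- then makes it reach `v`.
  have hclosed : C.IsClosedSubgraph H := by
    refine IsClosedSubgraph.mk' hCH fun e x he hx => ?_
    have hxN := (mem_vertexSet_iff hH.1.1).1 (hCH.vertexSet_mono hx)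
    have h1 : (H.incidenceSet x).ncard = 2 := by
      rw [incidenceSet_ncard_eq hH.1.1 hxN, hH.1.sum_multiplicity hxN]
    have h2 : C.incidenceSet x = H.incidenceSet x :=
      Set.eq_of_subset_of_ncard_le (fun f hf => Inc.mono hCH hf)
        (by rw [h1, hdef.ncard_eq hx]) (Set.finite_of_ncard_pos (by omega))
    have h3 : e ∈ C.incidenceSet x := by rw [h2]; exact he
    exact h3.edge_mem
  obtain ⟨l, x, e, -, -, hV, -, -⟩ := hC
  have hx : x 0 ∈ C.vertexSet := hV ▸ Set.mem_range_self 0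
  have := (hclosed.reflTransGen hx (hH.2.2 _ (hCH.vertexSet_mono hx) v
    ((mem_vertexSet_iff hH.1.1).2 hv))).1
  exact hvB (hCB.vertexSet_mono this)

theorem numHamiltonian_le_numCycleFree (hA : IsDecomposition A (completeMultigraph lam n))
    (hm : 1 ≤ m) (hAF : IsEmbeddedIn A F) :
    numHamiltonian F (completeMultigraph lam (n + m)) ≤ numCycleFree A :=
  Set.ncard_le_ncard (fun i hi => hi.isCycleFree (hAF i) (v := n) (by omega)
    (by rw [mem_vertexSet_iff (hA.spanning i)]; omega)) (Set.toFinite _)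

end Extension

end Graph

theorem mainTheorem4 (k m n r lam : ℕ) (hnm : 1 ≤ n + m)
    (A : Fin k → Graph ℕ (Sym2 ℕ × ℕ))
    (hA : Graph.IsPathDecomposition A (Graph.completeMultigraph lam n)) :
    (r ≤ Graph.numCycleFree A →
      ((∃ F : Fin k → Graph ℕ (Sym2 ℕ × ℕ),
          Graph.IsTwoFactorization F (Graph.completeMultigraph lam (n + m)) ∧
          Graph.IsEmbeddedIn A F ∧
          r ≤ Graph.numHamiltonian F (Graph.completeMultigraph lam (n + m))) ↔
        ((k : ℚ) = lam * (n + m - 1) / 2 ∧ ∀ i, (A i).pathComponents.encard ≤ m))) ∧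
    (1 ≤ m → r = Graph.numCycleFree A →
      ((∃ F : Fin k → Graph ℕ (Sym2 ℕ × ℕ),
          Graph.IsTwoFactorization F (Graph.completeMultigraph lam (n + m)) ∧
          Graph.IsEmbeddedIn A F ∧
          Graph.numHamiltonian F (Graph.completeMultigraph lam (n + m)) = r) ↔
        ((k : ℚ) = lam * (n + m - 1) / 2 ∧ ∀ i, (A i).pathComponents.encard ≤ m))) := by
  -- The right-hand side uses truncated subtraction, harmless because `1 ≤ n + m`.
  have hY1 : (k : ℚ) = lam * (n + m - 1) / 2 ↔ 2 * k = lam * (n + m - 1) := by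
    rw [eq_div_iff two_ne_zero, ← @Nat.cast_inj ℚ]
    push_cast [Nat.cast_sub hnm]
    rw [mul_comm]
  have hnec : ∀ F : Fin k → Graph ℕ (Sym2 ℕ × ℕ),
      Graph.IsTwoFactorization F (Graph.completeMultigraph lam (n + m)) →
      Graph.IsEmbeddedIn A F →
      (k : ℚ) = lam * (n + m - 1) / 2 ∧ ∀ i, (A i).pathComponents.encard ≤ m :=
    fun F hF hAF => ⟨hY1.2 (hF.two_mul_eq hnm), hF.encard_pathComponents_le hA hAF⟩
  refine ⟨fun hr => ⟨fun ⟨F, hF, hAF, _⟩ => hnec F hF hAF, fun ⟨h1, h2⟩ => ?_⟩,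
    fun hm hr => ⟨fun ⟨F, hF, hAF, _⟩ => hnec F hF hAF, fun ⟨h1, h2⟩ => ?_⟩⟩
  · obtain ⟨F, hF, hAF, hham⟩ := hA.exists_twoFactorization hnm (hY1.1 h1) h2
    exact ⟨F, hF, hAF, hr.trans hham⟩
  · obtain ⟨F, hF, hAF, hham⟩ := hA.exists_twoFactorization hnm (hY1.1 h1) h2
    -- The upper bound needs a new vertex: with `m = 0` a class of `A` may itself be a Hamiltonian
    -- cycle.
    exact ⟨F, hF, hAF, le_antisymm
      (hr ▸ Graph.numHamiltonian_le_numCycleFree hA.1 hm hAF) (hr ▸ hham)⟩
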